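/- Let $V=V^{[*]}$ be a differential graded vertex operator algebra over $\mathbb C$: a cochain complex $(V^{[*]},d)$ with vacuum $\mathbf 1\in V^{[0]}$, $d\mathbf 1=0$, and vertex operators $Y(u,x)=\sum_n u_n x^{-n-1}$ with $u_n$ of degree $|u|-2n-2$, compatible with $d$ and satisfying truncation, vacuum, creation and the Jacobi identity with Koszul signs; together with a conformal vector $\omega\in V^{[4]}$, $d\omega=0$, whose modes $L(n)=\omega_{n+1}$ satisfy the Virasoro relations, with $L(-1)v=v_{-2}\mathbf 1$, $V=\bigoplus_{n\in\frac12\mathbb Z}V_n$ the decomposition into $L(0)$-eigenspaces, $\omega\in V_2$, $\dim V_n<\infty$ and $V_n=0$ for $n\ll0$. Put $R(V)=V/C_2(V)$, where $C_2(V)=\mathrm{span}\{u_{-2}v\}$, with $\bar u\cdot\bar v=\overline{u_{-1}v}$, $\{\bar u,\bar v\}=\overline{u_0v}$ and the differential induced by $d$. Put $A(V)=V/O(V)$, where $O(V)$ is spanned by $u\circ v=\sum_{i\ge0}\binom{\mathrm{wt}\,u}{i}u_{i-2}v$, with $u* v=\sum_{i\ge0}\binom{\mathrm{wt}\,u}{i}u_{i-1}v$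 and $m*_r u=(-1)^{|u||m|}\sum_{i\ge0}\binom{\mathrm{wt}\,u-1}{i}u_{i-1}m$. Let $F^pA(V)$ and $W_nA(V)$ be the images of $\bigoplus_{q\le p}V^{[q]}$ and $\bigoplus_{m\le n}V_m$; let $\mathrm{gr}^{[*]}A(V)$ and $\mathrm{gr}_*A(V)$ be the associated graded spaces (with $\mathrm{gr}_n=W_n/W_{<n}$), and let $\mathrm{gr}_*\mathrm{gr}^{[*]}A(V)\cong\mathrm{gr}^{[*]}\mathrm{gr}_*A(V)$ be the double associated graded. On $\mathrm{gr}^{[*]}A(V)$ and on the double associated graded, the product is induced by $*$, the differential by $d$, and the bracket of the classes of $u,m$ is the class of $u*m-(-1)^{|u||m|}m*_r u$, of degree $-2$ (and weight $-1$); on $\mathrm{gr}_*A(V)$ the product and the differential are induced by $*$ and $d$. Sending $u$ to its class gives maps $\eta_F:R(V)\to\mathrm{gr}^{[*]}A(V)$, $\eta_W:R(V)\to\mathrm{gr}_*A(V)$ and $\eta_{FW}:R(V)\to\mathrm{gr}_*\mathrm{gr}^{[*]}A(V)$. For each such $\eta$ put $\eta(R(V))=R(V)/\bigl((\mathrm{Ker}\,\eta)\cdot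 R(V)\bigr)$, with the operations, degree, weight and filtrations induced from $V$. Theorem. All these operations are well defined, and sending the class of $m\in V$ to its class defines morphisms $$\psi_V:\eta_F(R(V))\to\mathrm{gr}^{[*]}A(V),\quad \varphi_V:\eta_W(R(V))\to\mathrm{gr}_*A(V),\quad \Psi_V:\eta_{FW}(R(V))\to\mathrm{gr}_*\mathrm{gr}^{[*]}A(V)$$ of, respectively, dg Poisson modules over $\mathrm{gr}^{[*]}A(V)$, weight graded differential filtered modules over $\mathrm{gr}_*A(V)$, and weight graded dg Poisson modules over $\mathrm{gr}_*\mathrm{gr}^{[*]}A(V)$. The map $\psi_V$ respects the filtrations induced by the weight and $\varphi_V$ those induced by the degree, so that they induce $(\mathrm{gr}_*\psi)_V:\mathrm{gr}_*\eta_F(R(V))\to\mathrm{gr}_*\mathrm{gr}^{[*]}A(V)$ and $(\mathrm{gr}^{[*]}\varphi)_V:\mathrm{gr}^{[*]}\eta_W(R(V))\to\mathrm{gr}^{[*]}\mathrm{gr}_*A(V)\cong\mathrm{gr}_*\mathrm{gr}^{[*]}A(V)$. The maps $\Psi_V$, $(\mathrm{gr}_*\psi)_V$, $(\mathrm{gr}^{[*]}\varphi)_V$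 and $\psi_V$ are isomorphisms: they are bijective and preserve the gradings, the actions, the brackets and the differentials. If $V^{[p]}=0$ for $p\ll0$, then $\varphi_V$ is an isomorphism of weight graded differential filtered modules as well: it is bijective and maps each step of the degree filtration onto the corresponding step. -/

import Mathlib

noncomputable section

namespace DGVertex

/-- The coefficient `u_n v` of `x ^ (-n-1)` in `Y(u, x) v`. -/
abbrev nprod {V : Type*} [AddCommGroup V] [Module ℂ V] (Y : V →ₗ[ℂ] VertexOperator ℂ V)
    (u : V) (n : ℤ) (v : V) : V :=
  VertexOperator.ncoeff (Y u) n v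

/-- A differential graded vertex algebra over `ℂ`. The formal variable `x` has degree `-2`, so `u_n`
has degree `|u| - 2n - 2`; `Y` takes values in Mathlib's vertex operators, which contain the
truncation property. The Jacobi identity is written in its component (Borcherds) form. -/
structure DGVertexAlgebra (V : Type*) [AddCommGroup V] [Module ℂ V] where
  /-- the homogeneous component `V^[p]` of cohomological degree `p` -/
  deg : ℤ → Submodule ℂ V
  deg_internal : DirectSum.IsInternal deg
  /-- the differential -/
  d : V →ₗ[ℂ] V
  d_deg : ∀ (p : ℤ) (v : V), v ∈ deg p → d v ∈ deg (p + 1)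
  d_d : ∀ v : V, d (d v) = 0
  /-- the vertex operator map -/
  Y : V →ₗ[ℂ] VertexOperator ℂ V
  /-- the vacuum -/
  one : V
  one_deg : one ∈ deg 0
  d_one : d one = 0
  prod_deg : ∀ (p q n : ℤ) (u v : V), u ∈ deg p → v ∈ deg q →
    nprod Y u n v ∈ deg (p + q - 2 * n - 2)
  d_prod : ∀ (p n : ℤ) (u v : V), u ∈ deg p →
    d (nprod Y u n v) = nprod Y (d u) n v + p.negOnePow • nprod Y u n (d v)
  vacuum : ∀ (n : ℤ) (v : V), nprod Y one n v = if n = -1 then v else 0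
  creation : ∀ v : V, nprod Y v (-1) one = v
  creation_nonneg : ∀ (n : ℤ) (v : V), 0 ≤ n → nprod Y v n one = 0
  jacobi : ∀ (p q : ℤ) (u v w : V), u ∈ deg p → v ∈ deg q → ∀ l m n : ℤ,
    ∑ᶠ i : ℕ, ((-1) ^ i * Ring.choose l i) •
        (nprod Y u (m + l - i) (nprod Y v (n + i) w) -
          (l + p * q).negOnePow • nprod Y v (n + l - i) (nprod Y u (m + i) w)) =
      ∑ᶠ i : ℕ, Ring.choose m i • nprod Y (nprod Y u (l + i) v) (m + n - i) w

namespace DGVertexAlgebra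

variable {V : Type*} [AddCommGroup V] [Module ℂ V] (A : DGVertexAlgebra V)

/-- The operator `L(n) = ω_{n+1}`, where `Y(ω, x) = ∑ L(n) x ^ (-n-2)`. -/
abbrev modeL (ω : V) (n : ℤ) : Module.End ℂ V := VertexOperator.ncoeff (A.Y ω) (n + 1)

end DGVertexAlgebra

/-- A differential graded vertex operator algebra. Weights lie in `½ℤ` and are indexed by
*twice the weight*: the index `k : ℤ` stands for the weight `k / 2`. -/
structure DGVertexOperatorAlgebra (V : Type*) [AddCommGroup V] [Module ℂ V] extends
    DGVertexAlgebra V where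
  /-- the conformal vector -/
  omega : V
  omega_deg : omega ∈ deg 4
  d_omega : d omega = 0
  /-- the central charge -/
  c : ℂ
  virasoro : ∀ (m n : ℤ) (v : V),
    toDGVertexAlgebra.modeL omega m (toDGVertexAlgebra.modeL omega n v) -
        toDGVertexAlgebra.modeL omega n (toDGVertexAlgebra.modeL omega m v) =
      ((m : ℂ) - n) • toDGVertexAlgebra.modeL omega (m + n) v +
        (if m + n = 0 then ((m : ℂ) ^ 3 - m) / 12 * c else 0) • v
  weight_internal : DirectSum.IsInternal fun k : ℤ =>
    Module.End.eigenspace (toDGVertexAlgebra.modeL omega 0) ((k : ℂ) / 2)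
  omega_weight : toDGVertexAlgebra.modeL omega 0 omega = (2 : ℂ) • omega
  weight_finite : ∀ k : ℤ, FiniteDimensional ℂ
    (Module.End.eigenspace (toDGVertexAlgebra.modeL omega 0) ((k : ℂ) / 2))
  weight_bounded : ∃ N : ℤ, ∀ k < N,
    Module.End.eigenspace (toDGVertexAlgebra.modeL omega 0) ((k : ℂ) / 2) = ⊥
  translation : ∀ v : V, toDGVertexAlgebra.modeL omega (-1) v = nprod Y v (-2) one

/-! ### Filtrations and associated graded spaces -/

section Filtration

variable {A B : Type*} [AddCommGroup A] [Module ℂ A] [AddCommGroup B] [Module ℂ B]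

/-- The associated graded space `⨁ F_p / F_{p-1}` of an increasing filtration. -/
def Gr (F : ℤ → Submodule ℂ A) : Type _ :=
  DirectSum ℤ fun p => F p ⧸ (F (p - 1)).submoduleOf (F p)

instance (F : ℤ → Submodule ℂ A) : AddCommGroup (Gr F) :=
  inferInstanceAs (AddCommGroup (DirectSum ℤ fun p => F p ⧸ (F (p - 1)).submoduleOf (F p)))

instance (F : ℤ → Submodule ℂ A) : Module ℂ (Gr F) :=
  inferInstanceAs (Module ℂ (DirectSum ℤ fun p => F p ⧸ (F (p - 1)).submoduleOf (F p)))

/-- The class in `F_p / F_{p-1}` of an element of `F_p`. -/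
def symb (F : ℤ → Submodule ℂ A) (p : ℤ) : F p →ₗ[ℂ] Gr F :=
  DirectSum.lof ℂ ℤ (fun p => F p ⧸ (F (p - 1)).submoduleOf (F p)) p ∘ₗ
    ((F (p - 1)).submoduleOf (F p)).mkQ

/-- The map of associated graded spaces induced by a map that preserves filtrations. -/
def grMap {F : ℤ → Submodule ℂ A} {G : ℤ → Submodule ℂ B} (f : A →ₗ[ℂ] B)
    (h : ∀ p, (F p).map f ≤ G p) : Gr F →ₗ[ℂ] Gr G :=
  DirectSum.lmap fun p =>
    Submodule.mapQ _ _ (f.restrict fun _ hx => h p (Submodule.mem_map_of_mem hx))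
      (fun _ hx => h (p - 1) (Submodule.mem_map_of_mem hx))

/-- The filtration that `W` induces on the associated graded space of `F`: its `n`-th step is
spanned by the images of `F_p ∩ W_n` in `F_p / F_{p-1}`. -/
def inducedFil (F W : ℤ → Submodule ℂ A) (n : ℤ) : Submodule ℂ (Gr F) :=
  ⨆ p, ((W n).comap (F p).subtype).map (symb F p)

/-- The class of an element of `F_p ∩ W_n` in `gr^W_n gr^F_p`. -/
def symb₂ (F W : ℤ → Submodule ℂ A) (p n : ℤ) :
    (F p ⊓ W n : Submodule ℂ A) →ₗ[ℂ] Gr (inducedFil F W) :=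
  symb (inducedFil F W) n ∘ₗ
    ((symb F p ∘ₗ Submodule.inclusion inf_le_left).codRestrict (inducedFil F W n) fun x =>
      (le_iSup (fun p => ((W n).comap (F p).subtype).map (symb F p)) p)
        ⟨⟨x.1, x.2.1⟩, x.2.2, rfl⟩)

theorem symb_eq_zero (F : ℤ → Submodule ℂ A) (p : ℤ) (x : F p) (h : (x : A) ∈ F (p - 1)) :
    symb F p x = 0 := by
  have : ((F (p - 1)).submoduleOf (F p)).mkQ x = 0 :=
    (Submodule.Quotient.mk_eq_zero _).2 h
  change DirectSum.lof ℂ ℤ (fun p => F p ⧸ (F (p - 1)).submoduleOf (F p)) p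
    (((F (p - 1)).submoduleOf (F p)).mkQ x) = 0
  rw [this, map_zero]

end Filtration

section Glue

variable {V X : Type*} [AddCommGroup V] [Module ℂ V] [AddCommGroup X] [Module ℂ X]

/-- The linear map on an internal direct sum that is `f p` on the `p`-th summand. -/
def glue {G : ℤ → Submodule ℂ V} (h : DirectSum.IsInternal G) (f : ∀ p, G p →ₗ[ℂ] X) :
    V →ₗ[ℂ] X :=
  DirectSum.toModule ℂ ℤ X f ∘ₗ
    (LinearEquiv.ofBijective (DirectSum.coeLinearMap G) h).symm.toLinearMap

theorem glue_apply {G : ℤ → Submodule ℂ V} (h : DirectSum.IsInternal G)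
    (f : ∀ p, G p →ₗ[ℂ] X) {p : ℤ} {v : V} (hv : v ∈ G p) : glue h f v = f p ⟨v, hv⟩ := by
  have : (LinearEquiv.ofBijective (DirectSum.coeLinearMap G) h).symm v =
      DirectSum.lof ℂ ℤ (fun p => G p) p ⟨v, hv⟩ := by
    rw [LinearEquiv.symm_apply_eq]
    exact (DirectSum.coeLinearMap_lof G p ⟨v, hv⟩).symm
  rw [glue, LinearMap.comp_apply, LinearEquiv.coe_coe, this, DirectSum.toModule_lof]

theorem internal_induction {G : ℤ → Submodule ℂ V} (h : DirectSum.IsInternal G)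
    (S : Submodule ℂ V) (hS : ∀ p, G p ≤ S) (v : V) : v ∈ S := by
  have h1 : iSup G ≤ S := iSup_le hS
  rw [h.submodule_iSup_eq_top] at h1
  exact h1 trivial

end Glue

namespace DGVertexOperatorAlgebra

variable {V : Type*} [AddCommGroup V] [Module ℂ V] (𝒱 : DGVertexOperatorAlgebra V)

/-- `u_n v` -/
abbrev prod (u : V) (n : ℤ) (v : V) : V := nprod 𝒱.Y u n v

/-- The subspace of weight `k / 2`. -/
def weight (k : ℤ) : Submodule ℂ V :=
  Module.End.eigenspace (𝒱.modeL 𝒱.omega 0) ((k : ℂ) / 2)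

/-- `F^p V = ⨁_{q ≤ p} V^[q]` -/
def degFil (p : ℤ) : Submodule ℂ V := ⨆ q : Set.Iic p, 𝒱.deg q

/-- `W_n V = ⨁_{m ≤ n} V_m`, with `n` replaced by `k / 2`. -/
def weightFil (k : ℤ) : Submodule ℂ V := ⨆ l : Set.Iic k, 𝒱.weight l

/-- `Res_x (Y(u, x) (1 + x) ^ a x ^ s v) = ∑_{i ≥ 0} (a choose i) u_{i+s} v` -/
def res (a : ℂ) (s : ℤ) (u v : V) : V := ∑ᶠ i : ℕ, Ring.choose a i • 𝒱.prod u (i + s) v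

/-- `u ∘ v` for `u` of weight `k / 2` -/
def circ (k : ℤ) (u v : V) : V := 𝒱.res ((k : ℂ) / 2) (-2) u v

/-- `u *_l v` for `u` of weight `k / 2` -/
def starL (k : ℤ) (u v : V) : V := 𝒱.res ((k : ℂ) / 2) (-1) u v

/-- `m *_r u` for `u` of weight `k / 2` and degree `p`, and `m` of degree `q` -/
def starR (k p q : ℤ) (m u : V) : V := (p * q).negOnePow • 𝒱.res ((k : ℂ) / 2 - 1) (-1) u m

/-- `O(V)`, spanned by all `u ∘ v` with `u` homogeneous in weight. -/
def zhuO : Submodule ℂ V :=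
  Submodule.span ℂ {x | ∃ (k : ℤ) (u v : V), u ∈ 𝒱.weight k ∧ x = 𝒱.circ k u v}

/-- The Zhu algebra `A(V) = V / O(V)` as a space. -/
abbrev Zhu : Type _ := V ⧸ 𝒱.zhuO

/-- The class `[v]` in `A(V)`. -/
abbrev zhuMk : V →ₗ[ℂ] 𝒱.Zhu := 𝒱.zhuO.mkQ

/-- `F^p A(V)`, the image of `F^p V`. -/
def zhuF (p : ℤ) : Submodule ℂ 𝒱.Zhu := (𝒱.degFil p).map 𝒱.zhuMk

/-- `W_{k/2} A(V)`, the image of `W_{k/2} V`. -/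
def zhuW (k : ℤ) : Submodule ℂ 𝒱.Zhu := (𝒱.weightFil k).map 𝒱.zhuMk

/-- `gr^[*] A(V)` -/
abbrev GrF : Type _ := Gr 𝒱.zhuF

/-- `gr_* A(V)` -/
abbrev GrW : Type _ := Gr 𝒱.zhuW

/-- `gr_* gr^[*] A(V)` -/
abbrev GrWF : Type _ := Gr (inducedFil 𝒱.zhuF 𝒱.zhuW)

/-- `gr^[*] gr_* A(V)` -/
abbrev GrFW : Type _ := Gr (inducedFil 𝒱.zhuW 𝒱.zhuF)

/-- `C_2(V)` -/
def c2 : Submodule ℂ V := Submodule.span ℂ {x | ∃ u v : V, x = 𝒱.prod u (-2) v}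

/-- `R(V) = V / C_2(V)` as a space. -/
abbrev R : Type _ := V ⧸ 𝒱.c2

/-- The class of `v` in `R(V)`. -/
abbrev rMk : V →ₗ[ℂ] 𝒱.R := 𝒱.c2.mkQ

/-! ### The symbol maps and the maps `η` -/

theorem weight_internal' : DirectSum.IsInternal 𝒱.weight := 𝒱.weight_internal

theorem deg_le (p : ℤ) : 𝒱.deg p ≤ 𝒱.degFil p :=
  le_iSup (fun q : Set.Iic p => 𝒱.deg q) ⟨p, le_refl p⟩

theorem weight_le (k : ℤ) : 𝒱.weight k ≤ 𝒱.weightFil k :=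
  le_iSup (fun q : Set.Iic k => 𝒱.weight q) ⟨k, le_refl k⟩

theorem deg_le_of {p q : ℤ} (h : q ≤ p) : 𝒱.deg q ≤ 𝒱.degFil p :=
  le_iSup (fun q : Set.Iic p => 𝒱.deg q) ⟨q, h⟩

theorem weight_le_of {k l : ℤ} (h : l ≤ k) : 𝒱.weight l ≤ 𝒱.weightFil k :=
  le_iSup (fun q : Set.Iic k => 𝒱.weight q) ⟨l, h⟩

theorem zhuMk_mem_F {p : ℤ} {u : V} (hu : u ∈ 𝒱.deg p) : 𝒱.zhuMk u ∈ 𝒱.zhuF p :=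
  Submodule.mem_map_of_mem (𝒱.deg_le p hu)

theorem zhuMk_mem_W {k : ℤ} {u : V} (hu : u ∈ 𝒱.weight k) : 𝒱.zhuMk u ∈ 𝒱.zhuW k :=
  Submodule.mem_map_of_mem (𝒱.weight_le k hu)

/-- The linear map `V → gr^[*] A(V)` that sends `u ∈ V^[p]` to the class of `[u]` in
`F^p A(V) / F^{p-1} A(V)`. -/
def sigmaF : V →ₗ[ℂ] 𝒱.GrF :=
  glue 𝒱.deg_internal fun p =>
    symb 𝒱.zhuF p ∘ₗ 𝒱.zhuMk.restrict fun _ hu => 𝒱.zhuMk_mem_F hu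

/-- The linear map `V → gr_* A(V)` that sends `u ∈ V_n` to the class of `[u]` in
`W_n A(V) / W_{<n} A(V)`. -/
def sigmaW : V →ₗ[ℂ] 𝒱.GrW :=
  glue 𝒱.weight_internal' fun k =>
    symb 𝒱.zhuW k ∘ₗ 𝒱.zhuMk.restrict fun _ hu => 𝒱.zhuMk_mem_W hu

theorem sigmaF_apply {p : ℤ} {u : V} (hu : u ∈ 𝒱.deg p) :
    𝒱.sigmaF u = symb 𝒱.zhuF p ⟨𝒱.zhuMk u, 𝒱.zhuMk_mem_F hu⟩ := by
  rw [sigmaF, glue_apply _ _ hu]; rfl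

theorem sigmaW_apply {k : ℤ} {u : V} (hu : u ∈ 𝒱.weight k) :
    𝒱.sigmaW u = symb 𝒱.zhuW k ⟨𝒱.zhuMk u, 𝒱.zhuMk_mem_W hu⟩ := by
  rw [sigmaW, glue_apply _ _ hu]; rfl

theorem mem_weight {k : ℤ} {u : V} :
    u ∈ 𝒱.weight k ↔ 𝒱.prod 𝒱.omega 1 u = ((k : ℂ) / 2) • u := by
  rw [weight, Module.End.mem_eigenspace_iff]
  rfl

/-- The projection of `V` to `V^[p]`. -/
def degProj (p : ℤ) : V →ₗ[ℂ] V :=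
  glue 𝒱.deg_internal fun q => if q = p then (𝒱.deg q).subtype else 0

theorem degProj_same {p : ℤ} {u : V} (hu : u ∈ 𝒱.deg p) : 𝒱.degProj p u = u := by
  rw [degProj, glue_apply _ _ hu]; simp

theorem degProj_ne {p q : ℤ} {u : V} (hu : u ∈ 𝒱.deg q) (h : q ≠ p) : 𝒱.degProj p u = 0 := by
  rw [degProj, glue_apply _ _ hu]; simp [h]

theorem degProj_mem (p : ℤ) (u : V) : 𝒱.degProj p u ∈ 𝒱.deg p := by
  refine internal_induction 𝒱.deg_internal ((𝒱.deg p).comap (𝒱.degProj p)) (fun q v hv => ?_) u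
  by_cases h : q = p
  · subst h; simpa [Submodule.mem_comap, 𝒱.degProj_same hv] using hv
  · simp [Submodule.mem_comap, 𝒱.degProj_ne hv h]

theorem degProj_omega (p : ℤ) (u : V) :
    𝒱.degProj p (𝒱.prod 𝒱.omega 1 u) = 𝒱.prod 𝒱.omega 1 (𝒱.degProj p u) := by
  let T : Module.End ℂ V := 𝒱.modeL 𝒱.omega 0
  refine internal_induction 𝒱.deg_internal
    (LinearMap.eqLocus (𝒱.degProj p ∘ₗ T) (T ∘ₗ 𝒱.degProj p)) (fun q v hv => ?_) u
  have h1 : T v ∈ 𝒱.deg q := by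
    have := 𝒱.prod_deg 4 q 1 𝒱.omega v 𝒱.omega_deg hv
    have e : 4 + q - 2 * 1 - 2 = q := by ring
    rw [e] at this
    exact this
  rw [LinearMap.mem_eqLocus]
  by_cases h : q = p
  · subst h; simp [𝒱.degProj_same hv, 𝒱.degProj_same h1]
  · simp [𝒱.degProj_ne hv h, 𝒱.degProj_ne h1 h]

theorem degProj_weight {k : ℤ} (p : ℤ) {u : V} (hu : u ∈ 𝒱.weight k) :
    𝒱.degProj p u ∈ 𝒱.weight k := by
  rw [mem_weight] at *
  rw [← degProj_omega, hu, map_smul]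

/-- Each homogeneous vector of weight `k / 2` is a sum of bihomogeneous vectors. -/
theorem weight_le_iSup (k : ℤ) : 𝒱.weight k ≤ ⨆ p, 𝒱.deg p ⊓ 𝒱.weight k := by
  classical
  intro u hu
  let _ := 𝒱.deg_internal.chooseDecomposition
  have h2 : ∀ (v : V) (p : ℤ), (DirectSum.decompose 𝒱.deg v p : V) = 𝒱.degProj p v := by
    intro v p
    refine internal_induction 𝒱.deg_internal (LinearMap.eqLocus
      ((𝒱.deg p).subtype ∘ₗ DirectSum.component ℂ ℤ _ p ∘ₗ
        (DirectSum.decomposeLinearEquiv 𝒱.deg).toLinearMap) (𝒱.degProj p)) (fun q w hw => ?_) v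
    rw [LinearMap.mem_eqLocus]
    change (DirectSum.decompose 𝒱.deg w p : V) = _
    by_cases h : q = p
    · subst h; rw [𝒱.degProj_same hw, DirectSum.decompose_of_mem_same _ hw]
    · rw [𝒱.degProj_ne hw h, DirectSum.decompose_of_mem_ne _ hw h]
  rw [← DirectSum.sum_support_decompose 𝒱.deg u]
  refine Submodule.sum_mem _ fun p _ => ?_
  refine Submodule.mem_iSup_of_mem p ⟨SetLike.coe_mem _, ?_⟩
  rw [h2]
  exact 𝒱.degProj_weight p hu

theorem bihom_induction (S : Submodule ℂ V)
    (hS : ∀ p k u, u ∈ 𝒱.deg p → u ∈ 𝒱.weight k → u ∈ S) (v : V) : v ∈ S :=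
  internal_induction 𝒱.weight_internal' S
    (fun k => (𝒱.weight_le_iSup k).trans (iSup_le fun p u hu => hS p k u hu.1 hu.2)) v

theorem sigmaF_mem {k : ℤ} {u : V} (hu : u ∈ 𝒱.weight k) :
    𝒱.sigmaF u ∈ inducedFil 𝒱.zhuF 𝒱.zhuW k := by
  have h : ⨆ p, 𝒱.deg p ⊓ 𝒱.weight k ≤ (inducedFil 𝒱.zhuF 𝒱.zhuW k).comap 𝒱.sigmaF := by
    refine iSup_le fun p v hv => ?_
    rw [Submodule.mem_comap, 𝒱.sigmaF_apply hv.1]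
    exact Submodule.mem_iSup_of_mem p ⟨_, 𝒱.zhuMk_mem_W hv.2, rfl⟩
  exact h (𝒱.weight_le_iSup k hu)

/-- The linear map `V → gr_* gr^[*] A(V)` that sends `u ∈ V_n^[p]` to the class of `[u]`. -/
def sigmaWF : V →ₗ[ℂ] 𝒱.GrWF :=
  glue 𝒱.weight_internal' fun k =>
    symb (inducedFil 𝒱.zhuF 𝒱.zhuW) k ∘ₗ 𝒱.sigmaF.restrict fun _ hu => 𝒱.sigmaF_mem hu

theorem sigmaWF_apply {p k : ℤ} {u : V} (hp : u ∈ 𝒱.deg p) (hk : u ∈ 𝒱.weight k) :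
    𝒱.sigmaWF u = symb₂ 𝒱.zhuF 𝒱.zhuW p k
      ⟨𝒱.zhuMk u, 𝒱.zhuMk_mem_F hp, 𝒱.zhuMk_mem_W hk⟩ := by
  rw [sigmaWF, glue_apply _ _ hk, symb₂, LinearMap.comp_apply, LinearMap.comp_apply]
  congr 1
  exact Subtype.ext (𝒱.sigmaF_apply hp)

theorem prod_zero (u : V) (n : ℤ) : nprod 𝒱.Y u n 0 = 0 := map_zero _

theorem prod_smul (a : ℂ) (u : V) (n : ℤ) (v : V) : 𝒱.prod u n (a • v) = a • 𝒱.prod u n v :=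
  map_smul _ _ _

theorem smul_prod (a : ℂ) (u : V) (n : ℤ) (v : V) : 𝒱.prod (a • u) n v = a • 𝒱.prod u n v := by
  change VertexOperator.ncoeff (𝒱.Y (a • u)) n v = a • VertexOperator.ncoeff (𝒱.Y u) n v
  rw [map_smul, map_smul]
  rfl

theorem add_prod (u u' : V) (n : ℤ) (v : V) :
    𝒱.prod (u + u') n v = 𝒱.prod u n v + 𝒱.prod u' n v := by
  change VertexOperator.ncoeff (𝒱.Y (u + u')) n v =
    VertexOperator.ncoeff (𝒱.Y u) n v + VertexOperator.ncoeff (𝒱.Y u') n v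
  rw [map_add, map_add]
  rfl

theorem choose_neg_two (i : ℕ) : (-1) ^ i * Ring.choose (-2 : ℤ) i = (i : ℤ) + 1 := by
  rw [Ring.choose_neg', Ring.multichoose_two, Units.smul_def, Int.coe_negOnePow_natCast,
    smul_eq_mul, ← mul_assoc, ← mul_pow]
  simp

/-- `(L(-1) v)_{n+1} = -(n+1) v_n` -/
theorem translation_prod {p : ℤ} {v : V} (hv : v ∈ 𝒱.deg p) (n : ℤ) (w : V) :
    𝒱.prod (𝒱.prod v (-2) 𝒱.one) (n + 1) w = -(n + 1) • 𝒱.prod v n w := by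
  have h := 𝒱.jacobi p 0 v 𝒱.one w hv 𝒱.one_deg (-2) 0 (n + 1)
  have hr : ∑ᶠ i : ℕ, Ring.choose (0 : ℤ) i •
      nprod 𝒱.Y (nprod 𝒱.Y v (-2 + i) 𝒱.one) (0 + (n + 1) - i) w =
      𝒱.prod (𝒱.prod v (-2) 𝒱.one) (n + 1) w := by
    rw [finsum_eq_single _ 0]
    · simp
    · intro i hi
      rw [Ring.choose_zero_pos _ (Nat.pos_of_ne_zero hi), zero_smul]
  rw [hr] at h
  rw [← h]
  have he : ((-2 : ℤ) + p * 0).negOnePow = 1 := by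
    rw [mul_zero, add_zero]; exact Int.negOnePow_even _ (by decide)
  simp only [choose_neg_two, 𝒱.vacuum, he, one_smul]
  rcases le_or_gt 0 n with hn | hn
  · obtain ⟨N, rfl⟩ := Int.eq_ofNat_of_zero_le hn
    rw [finsum_eq_single _ N]
    · rw [if_neg (by lia), if_pos (by lia), prod_zero, zero_sub, smul_neg, ← neg_smul, zero_add]
    · intro i hi
      rw [if_neg (by lia), if_neg (by lia), prod_zero, sub_zero, smul_zero]
  · rcases eq_or_ne n (-1) with rfl | hn1
    · rw [finsum_eq_zero_of_forall_eq_zero]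
      · simp
      · intro i
        rw [if_neg (by lia), if_neg (by lia), prod_zero, sub_zero, smul_zero]
    · obtain ⟨N, hN⟩ := Int.eq_ofNat_of_zero_le (show 0 ≤ -2 - n by lia)
      have hn' : n = -2 - (N : ℤ) := by lia
      subst hn'
      rw [finsum_eq_single _ N]
      · rw [if_pos (by lia), if_neg (by lia), sub_zero, zero_add]
        congr 1
        ring
      · intro i hi
        rw [if_neg (by lia), if_neg (by lia), prod_zero, sub_zero, smul_zero]

/-- `[L(0), v_n] = (L(-1) v)_{n+1} + (L(0) v)_n` -/
theorem omega_commutator {q : ℤ} {v : V} (hv : v ∈ 𝒱.deg q) (n : ℤ) (w : V) :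
    𝒱.prod 𝒱.omega 1 (𝒱.prod v n w) - 𝒱.prod v n (𝒱.prod 𝒱.omega 1 w) =
      𝒱.prod (𝒱.prod 𝒱.omega 0 v) (n + 1) w + 𝒱.prod (𝒱.prod 𝒱.omega 1 v) n w := by
  have h := 𝒱.jacobi 4 q 𝒱.omega v w 𝒱.omega_deg hv 0 1 n
  have he : ((0 : ℤ) + 4 * q).negOnePow = 1 := by
    exact Int.negOnePow_even _ ⟨2 * q, by ring⟩
  rw [finsum_eq_single _ 0, finsum_eq_sum_of_support_subset (s := Finset.range 2)] at h
  · rw [he] at h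
    simpa [Finset.sum_range_succ, add_comm] using h
  · intro i hi
    by_contra hc
    simp only [Finset.coe_range, Set.mem_Iio, not_lt] at hc
    apply hi
    have : Ring.choose (1 : ℤ) i = 0 := by
      have := Ring.choose_natCast (R := ℤ) 1 i
      rw [Nat.choose_eq_zero_of_lt (by lia)] at this
      simpa using this
    simp [this]
  · intro i hi
    rw [Ring.choose_zero_pos _ (Nat.pos_of_ne_zero hi), mul_zero, zero_smul]

theorem prod_weight {p k l n : ℤ} {u v : V} (hp : u ∈ 𝒱.deg p) (hu : u ∈ 𝒱.weight k)
    (hv : v ∈ 𝒱.weight l) : 𝒱.prod u n v ∈ 𝒱.weight (k + l - 2 * n - 2) := by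
  rw [mem_weight] at *
  have h := 𝒱.omega_commutator hp n v
  have ht : 𝒱.prod 𝒱.omega 0 u = 𝒱.prod u (-2) 𝒱.one := 𝒱.translation u
  rw [ht, 𝒱.translation_prod hp, hu, hv, sub_eq_iff_eq_add] at h
  rw [h]
  rw [smul_prod, prod_smul, ← Int.cast_smul_eq_zsmul ℂ, ← add_smul, ← add_smul]
  congr 1
  push_cast
  ring

theorem truncation (u v : V) : ∃ N : ℤ, ∀ n, N ≤ n → 𝒱.prod u n v = 0 := by
  refine ⟨-HahnSeries.order ((HahnModule.of ℂ).symm (𝒱.Y u v)), fun n hn => ?_⟩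
  exact VertexOperator.ncoeff_eq_zero_of_lt_order _ _ _ (by lia)

theorem circ_sub (k : ℤ) (u v : V) : ∃ N : ℕ, 𝒱.circ k u v - 𝒱.prod u (-2) v =
    ∑ i ∈ Finset.range N, Ring.choose ((k : ℂ) / 2) (i + 1) • 𝒱.prod u (i - 1) v := by
  obtain ⟨N, hN⟩ := 𝒱.truncation u v
  refine ⟨(N + 2).toNat, ?_⟩
  rw [circ, res, finsum_eq_sum_of_support_subset (s := Finset.range ((N + 2).toNat + 1)),
    Finset.sum_range_succ']
  · simp only [Nat.cast_add, Nat.cast_one, Nat.cast_zero, Ring.choose_zero_right, one_smul, zero_add,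
      add_sub_cancel_right]
    refine Finset.sum_congr rfl fun i _ => ?_
    congr 2
    ring
  · intro i hi
    by_contra hc
    simp only [Finset.coe_range, Set.mem_Iio, not_lt] at hc
    apply hi
    simp only
    rw [hN _ (by lia), smul_zero]

theorem zhuMk_prod_mem {p k q l : ℤ} {u v : V} (hp : u ∈ 𝒱.deg p) (hk : u ∈ 𝒱.weight k)
    (hq : v ∈ 𝒱.deg q) (hl : v ∈ 𝒱.weight l) :
    𝒱.zhuMk (𝒱.prod u (-2) v) ∈ 𝒱.zhuF (p + q - 2 * (-2) - 2 - 1) ∧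
      𝒱.zhuMk (𝒱.prod u (-2) v) ∈ 𝒱.zhuW (k + l - 2 * (-2) - 2 - 1) := by
  obtain ⟨N, h⟩ := 𝒱.circ_sub k u v
  have hO : 𝒱.zhuMk (𝒱.circ k u v) = 0 :=
    (Submodule.Quotient.mk_eq_zero _).2 (Submodule.subset_span ⟨k, u, v, hk, rfl⟩)
  have h2 : 𝒱.zhuMk (𝒱.prod u (-2) v) = 𝒱.zhuMk (-∑ i ∈ Finset.range N,
      Ring.choose ((k : ℂ) / 2) (i + 1) • 𝒱.prod u (i - 1) v) := by
    rw [← h, map_neg, map_sub, hO, zero_sub, neg_neg]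
  rw [h2]
  constructor
  · refine Submodule.mem_map_of_mem (neg_mem (Submodule.sum_mem _ fun i _ =>
      Submodule.smul_mem _ _ (𝒱.deg_le_of ?_ (𝒱.prod_deg p q _ u v hp hq))))
    lia
  · refine Submodule.mem_map_of_mem (neg_mem (Submodule.sum_mem _ fun i _ =>
      Submodule.smul_mem _ _ (𝒱.weight_le_of ?_ (𝒱.prod_weight hp hk hl))))
    lia

/-- A linear map that kills `u_{-2} v` for all bihomogeneous `u` and `v` kills `C_2(V)`. -/
theorem c2_le {X : Type*} [AddCommGroup X] [Module ℂ X] (f : V →ₗ[ℂ] X)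
    (h : ∀ p k q l u v, u ∈ 𝒱.deg p → u ∈ 𝒱.weight k → v ∈ 𝒱.deg q → v ∈ 𝒱.weight l →
      f (𝒱.prod u (-2) v) = 0) : 𝒱.c2 ≤ LinearMap.ker f := by
  refine Submodule.span_le.2 ?_
  rintro _ ⟨u, v, rfl⟩
  have hv : ∀ p k u, u ∈ 𝒱.deg p → u ∈ 𝒱.weight k → ∀ v, f (𝒱.prod u (-2) v) = 0 := by
    intro p k u hp hk v
    exact 𝒱.bihom_induction (LinearMap.ker (f ∘ₗ VertexOperator.ncoeff (𝒱.Y u) (-2)))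
      (fun q l v hq hl => h p k q l u v hp hk hq hl) v
  refine 𝒱.bihom_induction (LinearMap.ker (f ∘ₗ
    { toFun := fun u => 𝒱.prod u (-2) v
      map_add' := fun a b => 𝒱.add_prod a b _ _
      map_smul' := fun a b => 𝒱.smul_prod a b _ _ })) (fun p k u hp hk => hv p k u hp hk v) u

theorem c2_le_sigmaF : 𝒱.c2 ≤ LinearMap.ker 𝒱.sigmaF := by
  refine 𝒱.c2_le _ fun p k q l u v hp hk hq hl => ?_
  rw [𝒱.sigmaF_apply (𝒱.prod_deg p q _ u v hp hq)]
  exact symb_eq_zero _ _ _ (𝒱.zhuMk_prod_mem hp hk hq hl).1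

theorem c2_le_sigmaW : 𝒱.c2 ≤ LinearMap.ker 𝒱.sigmaW := by
  refine 𝒱.c2_le _ fun p k q l u v hp hk hq hl => ?_
  rw [𝒱.sigmaW_apply (𝒱.prod_weight hp hk hl)]
  exact symb_eq_zero _ _ _ (𝒱.zhuMk_prod_mem hp hk hq hl).2

theorem c2_le_sigmaWF : 𝒱.c2 ≤ LinearMap.ker 𝒱.sigmaWF := by
  refine 𝒱.c2_le _ fun p k q l u v hp hk hq hl => ?_
  rw [𝒱.sigmaWF_apply (𝒱.prod_deg p q _ u v hp hq) (𝒱.prod_weight hp hk hl), symb₂,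
    LinearMap.comp_apply]
  refine symb_eq_zero _ _ _ ?_
  have h0 : symb 𝒱.zhuF (p + q - 2 * (-2) - 2) ⟨𝒱.zhuMk (𝒱.prod u (-2) v),
      𝒱.zhuMk_mem_F (𝒱.prod_deg p q _ u v hp hq)⟩ = 0 :=
    symb_eq_zero _ _ _ (𝒱.zhuMk_prod_mem hp hk hq hl).1
  change symb 𝒱.zhuF (p + q - 2 * (-2) - 2) ⟨𝒱.zhuMk (𝒱.prod u (-2) v),
      𝒱.zhuMk_mem_F (𝒱.prod_deg p q _ u v hp hq)⟩ ∈ _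
  rw [h0]
  exact Submodule.zero_mem _

/-- `η_F : R(V) → gr^[*] A(V)` -/
def etaF : 𝒱.R →ₗ[ℂ] 𝒱.GrF := 𝒱.c2.liftQ 𝒱.sigmaF 𝒱.c2_le_sigmaF

/-- `η_W : R(V) → gr_* A(V)` -/
def etaW : 𝒱.R →ₗ[ℂ] 𝒱.GrW := 𝒱.c2.liftQ 𝒱.sigmaW 𝒱.c2_le_sigmaW

/-- `η_{FW} : R(V) → gr_* gr^[*] A(V)` -/
def etaWF : 𝒱.R →ₗ[ℂ] 𝒱.GrWF := 𝒱.c2.liftQ 𝒱.sigmaWF 𝒱.c2_le_sigmaWF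

/-! ### The modules `η(R(V)) = R(V) / (Ker η) R(V)` -/

/-- The subspace `(Ker f) R(V)` of `R(V)`, spanned by the products `ā · m̄ = class of a_{-1} m` with
`f ā = 0`. -/
def kerMul {X : Type*} [AddCommGroup X] [Module ℂ X] (f : 𝒱.R →ₗ[ℂ] X) : Submodule ℂ 𝒱.R :=
  Submodule.span ℂ {x | ∃ a m : V, f (𝒱.rMk a) = 0 ∧ x = 𝒱.rMk (𝒱.prod a (-1) m)}

/-- `R(V) / (Ker f) R(V)`; for `f = η` this is `η(R(V)) = gr A(V) ⊗_{R(V)} R(V)`. -/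
abbrev Eta {X : Type*} [AddCommGroup X] [Module ℂ X] (f : 𝒱.R →ₗ[ℂ] X) : Type _ :=
  𝒱.R ⧸ 𝒱.kerMul f

/-- The class of `m ∈ V` in `R(V) / (Ker f) R(V)`. -/
def etaMk {X : Type*} [AddCommGroup X] [Module ℂ X] (f : 𝒱.R →ₗ[ℂ] X) : V →ₗ[ℂ] 𝒱.Eta f :=
  (𝒱.kerMul f).mkQ ∘ₗ 𝒱.rMk

/-- The filtration of `R(V) / (Ker f) R(V)` induced by the degree. -/
def etaFilF {X : Type*} [AddCommGroup X] [Module ℂ X] (f : 𝒱.R →ₗ[ℂ] X) (p : ℤ) :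
    Submodule ℂ (𝒱.Eta f) :=
  (𝒱.degFil p).map (𝒱.etaMk f)

/-- The filtration of `R(V) / (Ker f) R(V)` induced by the weight. -/
def etaFilW {X : Type*} [AddCommGroup X] [Module ℂ X] (f : 𝒱.R →ₗ[ℂ] X) (k : ℤ) :
    Submodule ℂ (𝒱.Eta f) :=
  (𝒱.weightFil k).map (𝒱.etaMk f)

/-- `η_F(R(V))` -/
abbrev EtaF : Type _ := 𝒱.Eta 𝒱.etaF

/-- `η_W(R(V))` -/
abbrev EtaW : Type _ := 𝒱.Eta 𝒱.etaW

/-- `η_{FW}(R(V))` -/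
abbrev EtaWF : Type _ := 𝒱.Eta 𝒱.etaWF

/-- `gr_* η_F(R(V))` -/
abbrev GrEtaF : Type _ := Gr (𝒱.etaFilW 𝒱.etaF)

/-- `gr^[*] η_W(R(V))` -/
abbrev GrEtaW : Type _ := Gr (𝒱.etaFilF 𝒱.etaW)

end DGVertexOperatorAlgebra

/-! ### Module operations and isomorphisms -/

/-- The operations of a module with differential `X` over an algebra with underlying space `G`. -/
structure ModOps (G X : Type*) [AddCommGroup G] [Module ℂ G] [AddCommGroup X] [Module ℂ X] where
  /-- the action -/
  act : G →ₗ[ℂ] X →ₗ[ℂ] X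
  /-- the differential -/
  d : X →ₗ[ℂ] X

/-- The operations of a dg Poisson module `X` over a dg Poisson algebra with underlying space `G`. -/
structure PoissonOps (G X : Type*) [AddCommGroup G] [Module ℂ G] [AddCommGroup X] [Module ℂ X]
    extends ModOps G X where
  /-- the Poisson bracket -/
  bracket : G →ₗ[ℂ] X →ₗ[ℂ] X

section Iso

variable {G X Y : Type*} [AddCommGroup G] [Module ℂ G] [AddCommGroup X] [Module ℂ X]
  [AddCommGroup Y] [Module ℂ Y]

/-- `f` commutes with the actions and the differentials. -/
structure IsModHom (o : ModOps G X) (o' : ModOps G Y) (f : X →ₗ[ℂ] Y) : Prop where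
  map_act : ∀ a x, f (o.act a x) = o'.act a (f x)
  map_d : ∀ x, f (o.d x) = o'.d (f x)

/-- `f` is bijective and commutes with the actions, the Poisson brackets and the differentials. -/
structure IsPoissonIso (o : PoissonOps G X) (o' : PoissonOps G Y) (f : X →ₗ[ℂ] Y) : Prop extends
    IsModHom o.toModOps o'.toModOps f where
  map_bracket : ∀ a x, f (o.bracket a x) = o'.bracket a (f x)
  bijective : Function.Bijective f

end Iso

namespace DGVertexOperatorAlgebra

variable {V : Type*} [AddCommGroup V] [Module ℂ V] (𝒱 : DGVertexOperatorAlgebra V)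

/-- The representative `u *_l m - (-1)^{pq} m *_r u` of the Poisson bracket of the classes of
`u` (of degree `p` and weight `k / 2`) and `m` (of degree `q`). -/
def comm (k p q : ℤ) (u m : V) : V :=
  𝒱.starL k u m - (p * q).negOnePow • 𝒱.starR k p q m u

/-! The following predicates say that given operations are the ones induced by `V`; they determine
the operations, since the classes that they mention span. -/

/-- `ā · m̂` is the class of `a_{-1} m` and `d m̂` is the class of `d m`. -/
structure IsEtaMod {G : Type*} [AddCommGroup G] [Module ℂ G] (f : 𝒱.R →ₗ[ℂ] G)
    (o : ModOps G (𝒱.Eta f)) : Prop where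
  act : ∀ a m : V, o.act (f (𝒱.rMk a)) (𝒱.etaMk f m) = 𝒱.etaMk f (𝒱.prod a (-1) m)
  d : ∀ m : V, o.d (𝒱.etaMk f m) = 𝒱.etaMk f (𝒱.d m)

/-- Moreover `{ā, m̂}` is the class of `a_0 m`. -/
structure IsEtaPoisson {G : Type*} [AddCommGroup G] [Module ℂ G] (f : 𝒱.R →ₗ[ℂ] G)
    (o : PoissonOps G (𝒱.Eta f)) : Prop extends 𝒱.IsEtaMod f o.toModOps where
  bracket : ∀ a m : V, o.bracket (f (𝒱.rMk a)) (𝒱.etaMk f m) = 𝒱.etaMk f (𝒱.prod a 0 m)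

/-- The operations of `gr^[*] A(V)` as a dg Poisson module over itself. -/
structure IsGrF (o : PoissonOps 𝒱.GrF 𝒱.GrF) : Prop where
  act : ∀ (p q k : ℤ) (u m : V), u ∈ 𝒱.deg p → u ∈ 𝒱.weight k → m ∈ 𝒱.deg q →
    ∃ h, o.act (𝒱.sigmaF u) (𝒱.sigmaF m) = symb 𝒱.zhuF (p + q) ⟨𝒱.zhuMk (𝒱.starL k u m), h⟩
  bracket : ∀ (p q k : ℤ) (u m : V), u ∈ 𝒱.deg p → u ∈ 𝒱.weight k → m ∈ 𝒱.deg q →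
    ∃ h, o.bracket (𝒱.sigmaF u) (𝒱.sigmaF m) =
      symb 𝒱.zhuF (p + q - 2) ⟨𝒱.zhuMk (𝒱.comm k p q u m), h⟩
  d : ∀ (q : ℤ) (m : V), m ∈ 𝒱.deg q →
    ∃ h, o.d (𝒱.sigmaF m) = symb 𝒱.zhuF (q + 1) ⟨𝒱.zhuMk (𝒱.d m), h⟩

/-- The operations of `gr_* A(V)` as a module over itself. -/
structure IsGrW (o : ModOps 𝒱.GrW 𝒱.GrW) : Prop where
  act : ∀ (k l : ℤ) (u m : V), u ∈ 𝒱.weight k → m ∈ 𝒱.weight l →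
    ∃ h, o.act (𝒱.sigmaW u) (𝒱.sigmaW m) = symb 𝒱.zhuW (k + l) ⟨𝒱.zhuMk (𝒱.starL k u m), h⟩
  d : ∀ (l : ℤ) (m : V), m ∈ 𝒱.weight l →
    ∃ h, o.d (𝒱.sigmaW m) = symb 𝒱.zhuW l ⟨𝒱.zhuMk (𝒱.d m), h⟩

/-- The operations of `gr_* gr^[*] A(V)` as a dg Poisson module over itself; the bracket lowers the
weight by `1`, that is, the index by `2`. -/
structure IsGrWF (o : PoissonOps 𝒱.GrWF 𝒱.GrWF) : Prop where
  act : ∀ (p q k l : ℤ) (u m : V), u ∈ 𝒱.deg p → u ∈ 𝒱.weight k → m ∈ 𝒱.deg q → m ∈ 𝒱.weight l →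
    ∃ h, o.act (𝒱.sigmaWF u) (𝒱.sigmaWF m) =
      symb₂ 𝒱.zhuF 𝒱.zhuW (p + q) (k + l) ⟨𝒱.zhuMk (𝒱.starL k u m), h⟩
  bracket : ∀ (p q k l : ℤ) (u m : V), u ∈ 𝒱.deg p → u ∈ 𝒱.weight k → m ∈ 𝒱.deg q →
    m ∈ 𝒱.weight l → ∃ h, o.bracket (𝒱.sigmaWF u) (𝒱.sigmaWF m) =
      symb₂ 𝒱.zhuF 𝒱.zhuW (p + q - 2) (k + l - 2) ⟨𝒱.zhuMk (𝒱.comm k p q u m), h⟩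
  d : ∀ (q l : ℤ) (m : V), m ∈ 𝒱.deg q → m ∈ 𝒱.weight l →
    ∃ h, o.d (𝒱.sigmaWF m) = symb₂ 𝒱.zhuF 𝒱.zhuW (q + 1) l ⟨𝒱.zhuMk (𝒱.d m), h⟩

/-- The operations of `gr_* η_F(R(V))` as a dg Poisson module over `gr_* gr^[*] A(V)`. -/
structure IsGrEtaF (o : PoissonOps 𝒱.GrWF 𝒱.GrEtaF) : Prop where
  act : ∀ (p k l : ℤ) (a m : V), a ∈ 𝒱.deg p → a ∈ 𝒱.weight k → m ∈ 𝒱.weight l →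
    ∃ h h', o.act (𝒱.sigmaWF a) (symb (𝒱.etaFilW 𝒱.etaF) l ⟨𝒱.etaMk 𝒱.etaF m, h⟩) =
      symb (𝒱.etaFilW 𝒱.etaF) (k + l) ⟨𝒱.etaMk 𝒱.etaF (𝒱.prod a (-1) m), h'⟩
  bracket : ∀ (p k l : ℤ) (a m : V), a ∈ 𝒱.deg p → a ∈ 𝒱.weight k → m ∈ 𝒱.weight l →
    ∃ h h', o.bracket (𝒱.sigmaWF a) (symb (𝒱.etaFilW 𝒱.etaF) l ⟨𝒱.etaMk 𝒱.etaF m, h⟩) =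
      symb (𝒱.etaFilW 𝒱.etaF) (k + l - 2) ⟨𝒱.etaMk 𝒱.etaF (𝒱.prod a 0 m), h'⟩
  d : ∀ (l : ℤ) (m : V), m ∈ 𝒱.weight l →
    ∃ h h', o.d (symb (𝒱.etaFilW 𝒱.etaF) l ⟨𝒱.etaMk 𝒱.etaF m, h⟩) =
      symb (𝒱.etaFilW 𝒱.etaF) l ⟨𝒱.etaMk 𝒱.etaF (𝒱.d m), h'⟩

/-- The operations of `gr^[*] η_W(R(V))` as a dg Poisson module over
`gr_* gr^[*] A(V) ≅ gr^[*] gr_* A(V)`. -/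
structure IsGrEtaW (o : PoissonOps 𝒱.GrWF 𝒱.GrEtaW) : Prop where
  act : ∀ (p q k : ℤ) (a m : V), a ∈ 𝒱.deg p → a ∈ 𝒱.weight k → m ∈ 𝒱.deg q →
    ∃ h h', o.act (𝒱.sigmaWF a) (symb (𝒱.etaFilF 𝒱.etaW) q ⟨𝒱.etaMk 𝒱.etaW m, h⟩) =
      symb (𝒱.etaFilF 𝒱.etaW) (p + q) ⟨𝒱.etaMk 𝒱.etaW (𝒱.prod a (-1) m), h'⟩
  bracket : ∀ (p q k : ℤ) (a m : V), a ∈ 𝒱.deg p → a ∈ 𝒱.weight k → m ∈ 𝒱.deg q →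
    ∃ h h', o.bracket (𝒱.sigmaWF a) (symb (𝒱.etaFilF 𝒱.etaW) q ⟨𝒱.etaMk 𝒱.etaW m, h⟩) =
      symb (𝒱.etaFilF 𝒱.etaW) (p + q - 2) ⟨𝒱.etaMk 𝒱.etaW (𝒱.prod a 0 m), h'⟩
  d : ∀ (q : ℤ) (m : V), m ∈ 𝒱.deg q →
    ∃ h h', o.d (symb (𝒱.etaFilF 𝒱.etaW) q ⟨𝒱.etaMk 𝒱.etaW m, h⟩) =
      symb (𝒱.etaFilF 𝒱.etaW) (q + 1) ⟨𝒱.etaMk 𝒱.etaW (𝒱.d m), h'⟩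

/-- The component of bidegree `(p, k / 2)` of `gr_* η_F(R(V))`. -/
def grEtaFPiece (p k : ℤ) : Submodule ℂ 𝒱.GrEtaF :=
  ((((𝒱.deg p).map (𝒱.etaMk 𝒱.etaF)).comap (𝒱.etaFilW 𝒱.etaF k).subtype).map
    (symb (𝒱.etaFilW 𝒱.etaF) k))

/-- The component of bidegree `(p, k / 2)` of `gr^[*] η_W(R(V))`. -/
def grEtaWPiece (p k : ℤ) : Submodule ℂ 𝒱.GrEtaW :=
  ((((𝒱.weight k).map (𝒱.etaMk 𝒱.etaW)).comap (𝒱.etaFilF 𝒱.etaW p).subtype).map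
    (symb (𝒱.etaFilF 𝒱.etaW) p))

end DGVertexOperatorAlgebra
end DGVertex
end

noncomputable section

namespace DGVertex

open Finset Filter

/-! The source and the target of each of the three maps are the quotient of `V` by one and the same
subspace `K`. The maps are then the tautological identifications.

Two facts produce `K`. First, raising the mode of a product by one lowers the degree by 2 and the
weight by 1, so all terms of `u ∘ v` have the same value of degree minus twice the weight, and
`O(V)` is graded by this difference (`biProj_mem_zhuO`). Within a fixed value of the difference,
bounding the degree is the same as bounding the weight. Hence the symbol maps from `V` to `gr^[*]
A(V)`, to `gr_* A(V)` and to the two double gradeds have the same bigraded kernel `K` (`ker_sigmaW`,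
`sigmaWF_eq_zero_iff`, `sigmaFW_eq_zero_iff`), and the two double gradeds are identified.

Second, `K` is stable under `a_{-1} m`, `a_0 m`, on either side, and under `d`. These products are
the leading terms of `u * m` and of `u * m - (±) m *_r u`, both of which map `O(V)` in the first
argument into `O(V)` (`zhuOp_mem_zhuO`, from the Borcherds identity weighted by powers of `1 + x`).
So an element of `K` in the first argument gives an element of `K` (`sigmaF_prod_right`). The second
argument follows by skew symmetry, which holds modulo `C_2(V) ⊆ K`.

Thus `Ker η` is the image of `K` in `R(V)` and is an ideal containing all `a = a_{-1} 1` with `a ∈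
K`. Therefore `(Ker η) R(V) = Ker η`, and `η(R(V)) = V / K` (`etaMk_eq_zero_iff`). Passing to the
associated graded space of `V / K` for either filtration changes nothing, because `K` is bigraded.
Every operation in the statement descends from `a_{-1} m`, `a_0 m` or `d` on `V`, so all
compatibilities are read off on representatives. -/

/-- The coefficient extraction behind `(1 + y + z) ^ a (1 + y) ^ b`: the coefficient of `z ^ s` is
`(a choose s) (1 + y) ^ (a + b - s)`. -/
theorem sum_choose_mul_choose {M : Type*} [AddCommGroup M] [Module ℂ M] (a b : ℂ) (f : ℕ → M)
    {N₀ s N : ℕ} (hf : ∀ i, N₀ ≤ i → f i = 0) (hN : N₀ + s ≤ N) :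
    ∑ i ∈ range N, ∑ j ∈ range N,
        (Ring.choose a i * Ring.choose b j * (i.choose s : ℂ)) • f (i - s + j) =
      Ring.choose a s • ∑ r ∈ range N, Ring.choose (a + b - s) r • f r := by
  obtain ⟨N', rfl⟩ : ∃ N', N = s + N' := ⟨N - s, by lia⟩
  rw [sum_range_add, sum_eq_zero, zero_add]
  swap
  · intro i hi
    refine sum_eq_zero fun j _ => ?_
    rw [Nat.choose_eq_zero_of_lt (mem_range.1 hi)]
    simp
  have h1 : ∀ g : ℕ → M, (∀ i, N' ≤ i → g i = 0) →
      ∑ r ∈ range (s + N'), g r = ∑ r ∈ range N', g r := by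
    intro g hg
    refine (sum_subset (range_subset_range.2 (by lia)) fun x _ hx => hg x ?_).symm
    simpa using hx
  rw [h1 _ (fun i hi => by rw [hf i (by lia), smul_zero])]
  -- With `i = s + t`, use `(a choose i) (i choose s) = (a choose s) (a - s choose t)`. Cutting `j`
  -- at `N' - t` drops only zero values of `f` and leaves a triangle, on which Vandermonde's
  -- identity applies along the diagonals.
  have h2 : ∀ t ∈ range N', ∑ j ∈ range (s + N'), (Ring.choose a (s + t) * Ring.choose b j *
      ((s + t).choose s : ℂ)) • f (s + t - s + j) =
      Ring.choose a s • ∑ j ∈ range (N' - t),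
        (Ring.choose (a - s) t * Ring.choose b j) • f (t + j) := by
    intro t _
    have h3 := Ring.choose_smul_choose a (Nat.le_add_right s t)
    rw [Nat.add_sub_cancel_left, nsmul_eq_mul] at h3
    rw [smul_sum]
    symm
    refine (sum_subset (range_subset_range.2 (by lia)) fun x _ hx => ?_).trans
      (sum_congr rfl fun j _ => ?_)
    · rw [hf _ (by simp at hx; lia), smul_zero, smul_zero]
    · rw [Nat.add_sub_cancel_left, smul_smul, ← mul_assoc, ← h3]
      congr 1
      ring
  rw [sum_congr rfl h2, ← smul_sum,
    ← sum_range_diag_flip N' fun t j => (Ring.choose (a - s) t * Ring.choose b j) • f (t + j)]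
  congr 1
  refine sum_congr rfl fun m _ => ?_
  rw [show a + b - (s : ℂ) = (a - s) + b by ring, Ring.add_choose_eq m (Commute.all _ _),
    Nat.sum_antidiagonal_eq_sum_range_succ fun i j => Ring.choose (a - (s : ℂ)) i * Ring.choose b j,
    sum_smul]
  refine sum_congr rfl fun k hk => ?_
  rw [Nat.add_sub_of_le (by simpa [Nat.lt_succ_iff] using hk)]

/-! ### Residue products and the weighted Borcherds identity -/

namespace DGVertexOperatorAlgebra

variable {V : Type*} [AddCommGroup V] [Module ℂ V] (𝒱 : DGVertexOperatorAlgebra V)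

/-- `(u, v) ↦ u_n v` as a bilinear map -/
def prodL (n : ℤ) : V →ₗ[ℂ] V →ₗ[ℂ] V :=
  LinearMap.proj n ∘ₗ VertexOperator.ncoeff ∘ₗ 𝒱.Y

/-- Truncation makes the residue a finite sum. Allowing every large cutoff lets several residues
share one `N`. -/
theorem eventually_res (a : ℂ) (s : ℤ) (u v : V) : ∀ᶠ N in atTop,
    𝒱.res a s u v = ∑ i ∈ range N, Ring.choose a i • 𝒱.prod u (i + s) v := by
  obtain ⟨N₀, h⟩ := 𝒱.truncation u v
  filter_upwards [eventually_ge_atTop (N₀ - s).toNat] with N hN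
  refine finsum_eq_sum_of_support_subset _ fun i hi => ?_
  by_contra hc
  simp only [coe_range, Set.mem_Iio, not_lt] at hc
  exact hi (by simp only; rw [h _ (by lia), smul_zero])

/-- `res` as a bilinear map -/
def resL (a : ℂ) (s : ℤ) : V →ₗ[ℂ] V →ₗ[ℂ] V :=
  LinearMap.mk₂ ℂ (𝒱.res a s)
    (fun u u' v => by
      obtain ⟨N, h1, h2, h3⟩ := ((𝒱.eventually_res a s (u + u') v).and
        ((𝒱.eventually_res a s u v).and (𝒱.eventually_res a s u' v))).exists
      rw [h1, h2, h3, ← sum_add_distrib]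
      simp only [← smul_add, ← add_prod])
    (fun c u v => by
      obtain ⟨N, h1, h2⟩ := ((𝒱.eventually_res a s (c • u) v).and
        (𝒱.eventually_res a s u v)).exists
      rw [h1, h2, smul_sum]
      simp only [smul_prod, smul_comm c])
    (fun u v v' => by
      obtain ⟨N, h1, h2, h3⟩ := ((𝒱.eventually_res a s u (v + v')).and
        ((𝒱.eventually_res a s u v).and (𝒱.eventually_res a s u v'))).exists
      rw [h1, h2, h3, ← sum_add_distrib]
      simp only [← smul_add, map_add])
    (fun c u v => by
      obtain ⟨N, h1, h2⟩ := ((𝒱.eventually_res a s u (c • v)).and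
        (𝒱.eventually_res a s u v)).exists
      rw [h1, h2, smul_sum]
      simp only [prod_smul, smul_comm c])

/-- The Pascal identity `(1 + x) ^ (a + 1) = (1 + x) ^ a + (1 + x) ^ a x`. -/
theorem res_add_one (a : ℂ) (s : ℤ) (u v : V) :
    𝒱.res (a + 1) s u v = 𝒱.res a s u v + 𝒱.res a (s + 1) u v := by
  obtain ⟨N, h1, h2, h3⟩ := (((tendsto_add_atTop_nat 1).eventually
    (𝒱.eventually_res (a + 1) s u v)).and (((tendsto_add_atTop_nat 1).eventually
    (𝒱.eventually_res a s u v)).and (𝒱.eventually_res a (s + 1) u v))).exists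
  rw [h1, h2, h3, sum_range_succ', sum_range_succ']
  simp only [Ring.choose_succ_succ, add_smul, sum_add_distrib, Ring.choose_zero_right]
  have : ∀ i : ℕ, (i : ℤ) + (s + 1) = ((i + 1 : ℕ) : ℤ) + s := fun i => by push_cast; ring
  simp only [this]
  abel

/-- The Borcherds identity for vertex operators multiplied by `(1 + x) ^ a` and `(1 + y) ^ b`. -/
theorem res_jacobi {p q : ℤ} {u v : V} (hu : u ∈ 𝒱.deg p) (hv : v ∈ 𝒱.deg q) (a b : ℂ) (l n : ℤ)
    (w : V) : ∃ N₁, ∀ N₂, N₁ ≤ N₂ →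
      ∑ s ∈ range N₂, Ring.choose a s • 𝒱.res (a + b - s) n (𝒱.prod u (l + s) v) w =
      ∑ i ∈ range N₂, ((-1) ^ i * Ring.choose l i) •
        (𝒱.res a (l - i) u (𝒱.res b (n + i) v w) -
          (l + p * q).negOnePow • 𝒱.res b (n + l - i) v (𝒱.res a i u w)) := by
  obtain ⟨M₁, h1⟩ := 𝒱.truncation u v
  obtain ⟨M₂, h2⟩ := 𝒱.truncation u w
  obtain ⟨M₃, h3⟩ := 𝒱.truncation v w
  -- Beyond this bound `u_{l+s} v`, `u_i w` and `v_{n+i} w` all vanish, so both sums of the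
  -- Borcherds identity may be cut at `B`, uniformly in the shifts `i'` and `j'` below.
  refine ⟨(M₁ - l).toNat + M₂.toNat + (M₃ - n).toNat, fun B hB => ?_⟩
  have hs : ∀ᶠ N in atTop, ∀ s ∈ range B,
      Ring.choose a s • 𝒱.res (a + b - s) n (𝒱.prod u (l + s) v) w =
      ∑ i ∈ range N, ∑ j ∈ range N, (Ring.choose a i * Ring.choose b j * (i.choose s : ℂ)) •
        𝒱.prod (𝒱.prod u (l + s) v) (((i - s + j : ℕ) : ℤ) + n) w := by
    rw [eventually_all_finset]
    intro s _
    obtain ⟨M, hM⟩ := 𝒱.truncation (𝒱.prod u (l + s) v) w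
    filter_upwards [𝒱.eventually_res (a + b - s) n (𝒱.prod u (l + s) v) w,
      eventually_ge_atTop ((M - n).toNat + s)] with N hN hN'
    rw [hN, sum_choose_mul_choose a b
      (fun i => 𝒱.prod (𝒱.prod u (l + s) v) ((i : ℤ) + n) w) (fun i hi => hM _ (by lia)) hN']
  have hl : ∀ᶠ N in atTop, ∀ i ∈ range B,
      𝒱.res a (l - i) u (𝒱.res b (n + i) v w) = ∑ i' ∈ range N, ∑ j' ∈ range N,
        (Ring.choose a i' * Ring.choose b j') •
          𝒱.prod u (i' + (l - i)) (𝒱.prod v (j' + (n + i)) w) := by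
    rw [eventually_all_finset]
    intro i _
    filter_upwards [𝒱.eventually_res b (n + i) v w,
      𝒱.eventually_res a (l - i) u (𝒱.res b (n + i) v w)] with N hN hN'
    rw [hN', hN]
    simp only [map_sum, prod_smul, smul_sum, smul_smul]
  have hr : ∀ᶠ N in atTop, ∀ i ∈ range B,
      𝒱.res b (n + l - i) v (𝒱.res a i u w) = ∑ i' ∈ range N, ∑ j' ∈ range N,
        (Ring.choose a i' * Ring.choose b j') •
          𝒱.prod v (j' + (n + l - i)) (𝒱.prod u (i' + i) w) := by
    rw [eventually_all_finset]
    intro i _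
    filter_upwards [𝒱.eventually_res a i u w,
      𝒱.eventually_res b (n + l - i) v (𝒱.res a i u w)] with N hN hN'
    rw [hN', hN, sum_comm]
    simp only [map_sum, prod_smul, smul_sum, smul_smul, mul_comm]
  obtain ⟨N, hs, hl, hr⟩ := (hs.and (hl.and hr)).exists
  -- The Borcherds identity at `m = i'` and with `n + j'` in place of `n`. The claim is its sum over
  -- `i'`, `j'` with weights `(a choose i') (b choose j')`. The truncated difference `i' - s` is
  -- harmless, since `(i' choose s) = 0` for `i' < s`.
  have hJ : ∀ i' j' : ℕ, ∑ i ∈ range B, ((-1) ^ i * Ring.choose l i) •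
        (𝒱.prod u (i' + (l - i)) (𝒱.prod v (j' + (n + i)) w) -
          (l + p * q).negOnePow • 𝒱.prod v (j' + (n + l - i)) (𝒱.prod u (i' + i) w)) =
      ∑ s ∈ range B, (i'.choose s : ℂ) •
        𝒱.prod (𝒱.prod u (l + s) v) (((i' - s + j' : ℕ) : ℤ) + n) w := by
    intro i' j'
    have h := 𝒱.jacobi p q u v w hu hv l i' (n + j')
    rw [finsum_eq_sum_of_support_subset (s := range B),
      finsum_eq_sum_of_support_subset (s := range B)] at h
    · refine Eq.trans (sum_congr rfl fun i _ => ?_) (h.trans (sum_congr rfl fun s _ => ?_))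
      · rw [show (i' : ℤ) + (l - i) = i' + l - i by ring,
          show (j' : ℤ) + (n + i) = n + j' + i by ring,
          show (j' : ℤ) + (n + l - i) = n + j' + l - i by ring]
      · rw [Ring.choose_natCast, ← Int.cast_smul_eq_zsmul ℂ, Int.cast_natCast]
        rcases le_or_gt s i' with hsi | hsi
        · congr 3
          push_cast [hsi]
          ring
        · rw [Nat.choose_eq_zero_of_lt hsi]
          simp
    · intro i hi
      by_contra hc
      simp only [coe_range, Set.mem_Iio, not_lt] at hc
      refine hi ?_
      simp only
      have h0 : nprod 𝒱.Y u (l + i) v = 0 := h1 _ (by lia)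
      rw [h0]
      change _ • 𝒱.prodL _ 0 w = 0
      simp
    · intro i hi
      by_contra hc
      simp only [coe_range, Set.mem_Iio, not_lt] at hc
      refine hi ?_
      simp only
      have h0 : nprod 𝒱.Y u (i' + i) w = 0 := h2 _ (by lia)
      have h0' : nprod 𝒱.Y v (n + j' + i) w = 0 := h3 _ (by lia)
      rw [h0, h0', prod_zero, prod_zero, smul_zero, sub_zero, smul_zero]
  rw [sum_congr rfl hs, sum_comm]
  have hR : ∀ i' j' : ℕ, ∑ s ∈ range B, (Ring.choose a i' * Ring.choose b j' * (i'.choose s : ℂ)) •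
        𝒱.prod (𝒱.prod u (l + s) v) (((i' - s + j' : ℕ) : ℤ) + n) w =
      (Ring.choose a i' * Ring.choose b j') • ∑ i ∈ range B, ((-1) ^ i * Ring.choose l i) •
        (𝒱.prod u (i' + (l - i)) (𝒱.prod v (j' + (n + i)) w) -
          (l + p * q).negOnePow • 𝒱.prod v (j' + (n + l - i)) (𝒱.prod u (i' + i) w)) := by
    intro i' j'
    rw [hJ, smul_sum]
    simp only [smul_smul]
  have hL : ∀ i' ∈ range N, ∑ s ∈ range B, ∑ j' ∈ range N,
        (Ring.choose a i' * Ring.choose b j' * (i'.choose s : ℂ)) •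
        𝒱.prod (𝒱.prod u (l + s) v) (((i' - s + j' : ℕ) : ℤ) + n) w =
      ∑ i ∈ range B, ∑ j' ∈ range N, ((-1) ^ i * Ring.choose l i) •
        (Ring.choose a i' * Ring.choose b j') •
        (𝒱.prod u (i' + (l - i)) (𝒱.prod v (j' + (n + i)) w) -
          (l + p * q).negOnePow • 𝒱.prod v (j' + (n + l - i)) (𝒱.prod u (i' + i) w)) := by
    intro i' _
    rw [sum_comm, sum_congr rfl fun j' _ => hR i' j']
    simp only [smul_sum]
    rw [sum_comm]
    simp only [smul_comm (_ : ℂ) (_ : ℤ)]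
  rw [sum_congr rfl hL, sum_comm]
  refine sum_congr rfl fun i hi => ?_
  rw [hl i hi, hr i hi]
  simp only [smul_sub, sum_sub_distrib, smul_sum, Units.smul_def, smul_comm (_ : ℂ) (_ : ℤ)]

/-! ### Translation, and stability of `O(V)` under right multiplication -/

theorem one_weight : 𝒱.one ∈ 𝒱.weight 0 := by
  rw [mem_weight]
  simpa using 𝒱.creation_nonneg 1 𝒱.omega (by norm_num)

theorem translation_prod' {p : ℤ} {u : V} (hu : u ∈ 𝒱.deg p) (n : ℤ) (v : V) :
    𝒱.prod (𝒱.prod u (-2) 𝒱.one) n v = (-(n : ℂ)) • 𝒱.prod u (n - 1) v := by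
  have := 𝒱.translation_prod hu (n - 1) v
  rw [sub_add_cancel, ← Int.cast_smul_eq_zsmul ℂ] at this
  rw [this]
  push_cast
  rfl

/-- Integration by parts in `Res_x ((1 + x) ^ (a + 1) x ^ s (d/dx) Y(u, x) v)`. -/
theorem translation_res {p : ℤ} {u : V} (hu : u ∈ 𝒱.deg p) (a : ℂ) (s : ℤ) (v : V) :
    𝒱.res (a + 1) s (𝒱.prod u (-2) 𝒱.one) v =
      -((a + 1) • 𝒱.res a s u v) - (s : ℂ) • 𝒱.res (a + 1) (s - 1) u v := by
  obtain ⟨N, h1, h2, h3⟩ := (((tendsto_add_atTop_nat 1).eventually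
    (𝒱.eventually_res (a + 1) s (𝒱.prod u (-2) 𝒱.one) v)).and
    (((tendsto_add_atTop_nat 1).eventually (𝒱.eventually_res (a + 1) (s - 1) u v)).and
    (𝒱.eventually_res a s u v))).exists
  -- The derivative of `(1 + x) ^ (a + 1)`, coefficient by coefficient.
  have hc : ∀ i : ℕ, (a + 1) * Ring.choose a i = Ring.choose (a + 1) (i + 1) * (i + 1) := by
    intro i
    have := Ring.choose_smul_choose (a + 1) (Nat.le_add_left 1 i)
    rw [Ring.choose_one_right, Nat.choose_one_right, nsmul_eq_mul, Nat.add_sub_cancel] at this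
    push_cast at this
    rw [add_sub_cancel_right] at this
    rw [← this, mul_comm]
  rw [h1, h2, h3, eq_sub_iff_add_eq, smul_sum, ← sum_add_distrib, smul_sum, ← sum_neg_distrib,
    sum_range_succ']
  simp only [𝒱.translation_prod' hu]
  have h0 : ∀ i : ℕ, ((i + 1 : ℕ) : ℤ) + (s - 1) = i + s := fun i => by push_cast; ring
  have h0' : ∀ i : ℕ, ((i + 1 : ℕ) : ℤ) + s - 1 = i + s := fun i => by push_cast; ring
  have h4 : ∀ i : ℕ, (i : ℤ) + s - 1 = i + (s - 1) := fun i => by ring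
  rw [h4]
  simp only [h0, h0', smul_smul, hc, ← add_smul, ← neg_smul]
  have hz : Ring.choose (a + 1) 0 * -(((0 : ℕ) + s : ℤ) : ℂ) + s * Ring.choose (a + 1) 0 = 0 := by
    push_cast; ring
  rw [hz, zero_smul, add_zero]
  refine sum_congr rfl fun i _ => ?_
  congr 1
  push_cast
  ring

/-- Induction on the pole order. Applying the first membership to `L(-1) u`, of weight one more, and
integrating by parts gives the second one up to the factor `m + 2 ≠ 0`. The Pascal identity then
subtracts the first from the second to reach the next pole order. -/
theorem res_mem_zhuO (m : ℕ) : ∀ {p k : ℤ} {u : V}, u ∈ 𝒱.deg p → u ∈ 𝒱.weight k → ∀ v : V,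
    𝒱.res ((k : ℂ) / 2) (-2 - m) u v ∈ 𝒱.zhuO ∧
      𝒱.res ((k : ℂ) / 2 + 1) (-3 - m) u v ∈ 𝒱.zhuO := by
  have step : ∀ m : ℕ, (∀ {p k : ℤ} {u : V}, u ∈ 𝒱.deg p → u ∈ 𝒱.weight k → ∀ v : V,
      𝒱.res ((k : ℂ) / 2) (-2 - m) u v ∈ 𝒱.zhuO) → ∀ {p k : ℤ} {u : V}, u ∈ 𝒱.deg p →
      u ∈ 𝒱.weight k → ∀ v : V, 𝒱.res ((k : ℂ) / 2 + 1) (-3 - m) u v ∈ 𝒱.zhuO := by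
    intro m ih p k u hp hk v
    have h := 𝒱.translation_res hp ((k : ℂ) / 2) (-2 - m) v
    have h1 := ih (𝒱.prod_deg _ _ (-2) _ _ hp 𝒱.one_deg)
      (𝒱.prod_weight (n := -2) hp hk 𝒱.one_weight) v
    rw [show ((k + 0 - 2 * (-2) - 2 : ℤ) : ℂ) / 2 = (k : ℂ) / 2 + 1 by push_cast; ring, h] at h1
    have h2 := Submodule.add_mem _ h1 (Submodule.smul_mem _ ((k : ℂ) / 2 + 1) (ih hp hk v))
    rw [sub_eq_add_neg, add_right_comm, neg_add_cancel, zero_add, ← neg_smul,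
      show (-2 - m - 1 : ℤ) = -3 - m by ring] at h2
    refine (Submodule.smul_mem_iff _ ?_).1 h2
    push_cast
    rw [neg_sub, sub_neg_eq_add]
    exact_mod_cast (by lia : m + 2 ≠ 0)
  induction m with
  | zero =>
    have h0 : ∀ {p k : ℤ} {u : V}, u ∈ 𝒱.deg p → u ∈ 𝒱.weight k → ∀ v : V,
        𝒱.res ((k : ℂ) / 2) (-2 - (0 : ℕ)) u v ∈ 𝒱.zhuO := by
      intro p k u _ hk v
      exact Submodule.subset_span ⟨k, u, v, hk, by simp [circ]⟩
    exact fun {p k u} hp hk v => ⟨h0 hp hk v, step 0 h0 hp hk v⟩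
  | succ m ih =>
    have h0 : ∀ {p k : ℤ} {u : V}, u ∈ 𝒱.deg p → u ∈ 𝒱.weight k → ∀ v : V,
        𝒱.res ((k : ℂ) / 2) (-2 - (m + 1 : ℕ)) u v ∈ 𝒱.zhuO := by
      intro p k u hp hk v
      have h := 𝒱.res_add_one ((k : ℂ) / 2) (-3 - m) u v
      rw [show (-3 - m + 1 : ℤ) = -2 - m by ring] at h
      rw [show (-2 - (m + 1 : ℕ) : ℤ) = -3 - m by push_cast; ring, ← sub_eq_iff_eq_add.2 h]
      exact Submodule.sub_mem _ (ih hp hk v).2 (ih hp hk v).1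
    exact fun {p k u} hp hk v => ⟨h0 hp hk v, step (m + 1) h0 hp hk v⟩

/-- `O(V)` is spanned by the `u ∘ v` with `u` and `v` bihomogeneous. -/
theorem zhuO_le (S : Submodule ℂ V)
    (h : ∀ p k q l u v, u ∈ 𝒱.deg p → u ∈ 𝒱.weight k → v ∈ 𝒱.deg q → v ∈ 𝒱.weight l →
      𝒱.circ k u v ∈ S) : 𝒱.zhuO ≤ S := by
  refine Submodule.span_le.2 ?_
  rintro _ ⟨k, u, v, hu, rfl⟩
  have h1 : 𝒱.weight k ≤ S.comap ((𝒱.resL ((k : ℂ) / 2) (-2)).flip v) := by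
    refine (𝒱.weight_le_iSup k).trans (iSup_le fun p u hu => ?_)
    exact 𝒱.bihom_induction (S.comap (𝒱.resL ((k : ℂ) / 2) (-2) u))
      (fun q l v hq hl => h p k q l u v hu.1 hu.2 hq hl) v
  exact h1 hu

/-- `(u, v) ↦ Res_x (Y((1 + x) ^ L(0) u, x) (1 + x) ^ c x ^ s v)` as a bilinear map -/
def zhuOp (c : ℂ) (s : ℤ) : V →ₗ[ℂ] V →ₗ[ℂ] V :=
  glue 𝒱.weight_internal' fun k => 𝒱.resL ((k : ℂ) / 2 + c) s ∘ₗ (𝒱.weight k).subtype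

theorem zhuOp_apply (c : ℂ) (s : ℤ) {k : ℤ} {u : V} (hu : u ∈ 𝒱.weight k) (v : V) :
    𝒱.zhuOp c s u v = 𝒱.res ((k : ℂ) / 2 + c) s u v := by
  rw [zhuOp, glue_apply _ _ hu]
  rfl

/-- The pair `(0, -1)` is `o * w`, and `(-1, 0)` is the representative of the bracket (see
`comm_eq`). For `o = u ∘ v`, the weighted Borcherds identity expands the result into residues with
outer operator `u` or `v`, whose exponents are exactly those of `res_mem_zhuO`. -/
theorem zhuOp_mem_zhuO {c : ℂ} {s : ℤ} (h : c = 0 ∧ s = -1 ∨ c = -1 ∧ s = 0) {o : V}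
    (ho : o ∈ 𝒱.zhuO) (w : V) : 𝒱.zhuOp c s o w ∈ 𝒱.zhuO := by
  refine 𝒱.zhuO_le (𝒱.zhuO.comap ((𝒱.zhuOp c s).flip w)) (fun p k q l u v hp hk hq hl => ?_) ho
  -- Since `u_{i-2} v` has weight `wt u + wt v + 1 - i`, this second exponent makes the left side
  -- equal to the operation applied to `u ∘ v`.
  obtain ⟨N₁, hN₁⟩ := 𝒱.res_jacobi hp hq ((k : ℂ) / 2) ((l : ℂ) / 2 + 1 + c) (-2) s w
  obtain ⟨N, hN, hle⟩ := ((𝒱.eventually_res ((k : ℂ) / 2) (-2) u v).and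
    (eventually_ge_atTop N₁)).exists
  have key : 𝒱.zhuOp c s (𝒱.circ k u v) w = ∑ i ∈ range N, Ring.choose ((k : ℂ) / 2) i •
      𝒱.res ((k : ℂ) / 2 + ((l : ℂ) / 2 + 1 + c) - i) s (𝒱.prod u (-2 + i) v) w := by
    rw [circ, hN, map_sum, LinearMap.sum_apply]
    refine sum_congr rfl fun i _ => ?_
    rw [map_smul, LinearMap.smul_apply, 𝒱.zhuOp_apply c s (𝒱.prod_weight hp hk hl), add_comm (i : ℤ)]
    congr 2
    push_cast
    ring
  rw [Submodule.mem_comap, LinearMap.flip_apply, key, hN₁ N hle]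
  refine Submodule.sum_mem _ fun i _ => zsmul_mem (Submodule.sub_mem _ ?_ ?_) _
  · exact (𝒱.res_mem_zhuO i hp hk _).1
  · rw [Units.smul_def]
    refine zsmul_mem ?_ _
    rcases h with ⟨rfl, rfl⟩ | ⟨rfl, rfl⟩
    -- For `*`, the exponent `wt v + 1` is paid for by one more pole; for the bracket the exponent
    -- is `wt v` and the pole order is two or more.
    · rw [add_zero, show (-1 + -2 - i : ℤ) = -3 - i by ring]
      exact (𝒱.res_mem_zhuO i hq hl _).2
    · rw [add_neg_cancel_right, zero_add]
      exact (𝒱.res_mem_zhuO i hq hl _).1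

/-! ### The differential and skew symmetry -/

theorem d_res {p : ℤ} {u : V} (hu : u ∈ 𝒱.deg p) (a : ℂ) (s : ℤ) (v : V) :
    𝒱.d (𝒱.res a s u v) = 𝒱.res a s (𝒱.d u) v + p.negOnePow • 𝒱.res a s u (𝒱.d v) := by
  obtain ⟨N, h1, h2, h3⟩ := ((𝒱.eventually_res a s u v).and
    ((𝒱.eventually_res a s (𝒱.d u) v).and (𝒱.eventually_res a s u (𝒱.d v)))).exists
  rw [h1, h2, h3, map_sum, smul_sum, ← sum_add_distrib]
  refine sum_congr rfl fun i _ => ?_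
  rw [map_smul, 𝒱.d_prod p _ u v hu, smul_add, Units.smul_def, Units.smul_def,
    smul_comm (_ : ℂ) (_ : ℤ)]

/-- As `ω` is closed of even degree, `d` commutes with `L(0)`. -/
theorem d_weight {k : ℤ} {u : V} (hu : u ∈ 𝒱.weight k) : 𝒱.d u ∈ 𝒱.weight k := by
  rw [mem_weight] at *
  have h := 𝒱.d_prod 4 1 𝒱.omega u 𝒱.omega_deg
  have h0 : nprod 𝒱.Y 0 1 u = 0 := LinearMap.congr_fun (map_zero (𝒱.prodL 1)) u
  rw [𝒱.d_omega, h0, zero_add, Int.negOnePow_even 4 (by decide), one_smul] at h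
  rw [← map_smul, ← hu]
  exact h.symm

theorem d_mem_zhuO {o : V} (ho : o ∈ 𝒱.zhuO) : 𝒱.d o ∈ 𝒱.zhuO := by
  refine 𝒱.zhuO_le (𝒱.zhuO.comap 𝒱.d) (fun p k q l u v hp hk hq hl => ?_) ho
  rw [Submodule.mem_comap, circ, 𝒱.d_res hp, Units.smul_def]
  have h : 𝒱.circ k u (𝒱.d v) ∈ 𝒱.zhuO := Submodule.subset_span ⟨k, _, _, hk, rfl⟩
  exact 𝒱.zhuO.add_mem (Submodule.subset_span ⟨k, _, _, 𝒱.d_weight hk, rfl⟩) (zsmul_mem h _)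

/-- From `(L(-1) u)_{-2-i} v = (i + 2) u_{-3-i} v` with `i + 2` invertible. -/
theorem prod_mem_c2 (i : ℕ) : ∀ u v : V, 𝒱.prod u (-2 - i) v ∈ 𝒱.c2 := by
  induction i with
  | zero => exact fun u v => Submodule.subset_span ⟨u, v, by simp⟩
  | succ i ih =>
    intro u v
    refine internal_induction 𝒱.deg_internal (𝒱.c2.comap ((𝒱.prodL (-2 - (i + 1 : ℕ))).flip v))
      (fun p u hu => ?_) u
    have h := ih (𝒱.prod u (-2) 𝒱.one) v
    rw [𝒱.translation_prod' hu] at h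
    have h1 := (Submodule.smul_mem_iff _ ?_).1 h
    · rw [show (-2 - i - 1 : ℤ) = -2 - (i + 1 : ℕ) by push_cast; ring] at h1
      exact h1
    · push_cast
      rw [neg_sub, sub_neg_eq_add]
      exact_mod_cast (by lia : i + 2 ≠ 0)

/-- Skew symmetry modulo `C_2(V)` -/
theorem skew_mem_c2 {p q : ℤ} {u v : V} (hu : u ∈ 𝒱.deg p) (hv : v ∈ 𝒱.deg q) (l : ℤ) :
    𝒱.prod u l v + (l + p * q).negOnePow • 𝒱.prod v l u ∈ 𝒱.c2 := by
  -- With `w = 1`, `m = -1` and `n = 0`, creation leaves only `∓ v_l u` on the left. On the right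
  -- the term `i = 0` is `u_l v`, and the others are modes of index at most `-2`.
  have h := 𝒱.jacobi p q u v 𝒱.one hu hv l (-1) 0
  rw [finsum_eq_single _ 0] at h
  swap
  · intro i hi
    rw [𝒱.creation_nonneg (0 + i) v (by lia), 𝒱.creation_nonneg (-1 + i) u (by lia), prod_zero,
      prod_zero, smul_zero, sub_zero, smul_zero]
  obtain ⟨N, hN⟩ := 𝒱.truncation u v
  have hf : ∑ᶠ i : ℕ, Ring.choose (-1 : ℤ) i •
      nprod 𝒱.Y (nprod 𝒱.Y u (l + i) v) (-1 + 0 - i) 𝒱.one = ∑ i ∈ range ((N - l).toNat + 1),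
      Ring.choose (-1 : ℤ) i • nprod 𝒱.Y (nprod 𝒱.Y u (l + i) v) (-1 + 0 - i) 𝒱.one := by
    refine finsum_eq_sum_of_support_subset _ fun i hi => ?_
    by_contra hc
    simp only [coe_range, Set.mem_Iio, not_lt] at hc
    refine hi ?_
    have h0 : nprod 𝒱.Y u (l + i) v = 0 := hN _ (by lia)
    simp only [h0]
    change _ • 𝒱.prodL _ 0 _ = 0
    simp
  rw [hf, sum_range_succ'] at h
  simp only [Nat.cast_zero, Ring.choose_zero_right, pow_zero, one_smul, add_zero, sub_zero,
    mul_one, 𝒱.creation, 𝒱.creation_nonneg 0 v le_rfl, prod_zero, zero_sub, zero_add] at h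
  have h2 : 𝒱.prod u l v + (l + p * q).negOnePow • 𝒱.prod v l u =
      -∑ i ∈ range (N - l).toNat, Ring.choose (-1 : ℤ) (i + 1) •
        nprod 𝒱.Y (nprod 𝒱.Y u (l + (i + 1 : ℕ)) v) (-1 - (i + 1 : ℕ)) 𝒱.one := by
    rw [eq_neg_iff_add_eq_zero, add_right_comm, add_comm (𝒱.prod u l v), ← h, neg_add_cancel]
  rw [h2]
  refine neg_mem (Submodule.sum_mem _ fun i _ => zsmul_mem ?_ _)
  have := 𝒱.prod_mem_c2 i (nprod 𝒱.Y u (l + (i + 1 : ℕ)) v) 𝒱.one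
  rwa [show (-2 - i : ℤ) = -1 - (i + 1 : ℕ) by push_cast; ring] at this

end DGVertexOperatorAlgebra

/-! ### Associated graded spaces of images of graded spaces -/

section Proj

variable {V : Type*} [AddCommGroup V] [Module ℂ V] {G : ℤ → Submodule ℂ V}
  (h : DirectSum.IsInternal G)

/-- The projection to the `p`-th summand of an internal direct sum. -/
def proj (p : ℤ) : V →ₗ[ℂ] V := glue h fun q => if q = p then (G q).subtype else 0

theorem proj_same {p : ℤ} {u : V} (hu : u ∈ G p) : proj h p u = u := by
  rw [proj, glue_apply _ _ hu]; simp

theorem proj_ne {p q : ℤ} {u : V} (hu : u ∈ G q) (hq : q ≠ p) : proj h p u = 0 := by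
  rw [proj, glue_apply _ _ hu]; simp [hq]

theorem proj_mem (p : ℤ) (u : V) : proj h p u ∈ G p := by
  refine internal_induction h ((G p).comap (proj h p)) (fun q v hv => ?_) u
  by_cases hq : q = p
  · subst hq; simpa [Submodule.mem_comap, proj_same h hv] using hv
  · simp [Submodule.mem_comap, proj_ne h hv hq]

theorem mem_of_proj_mem (S : Submodule ℂ V) {v : V} (hv : ∀ p, proj h p v ∈ S) : v ∈ S := by
  classical
  -- The vectors that every sufficiently large finite sum of projections recovers. Quantifying over
  -- all larger index sets makes this closed under addition.
  let D : Submodule ℂ V :=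
    { carrier := {v | ∃ T : Finset ℤ, ∀ T', T ⊆ T' → ∑ p ∈ T', proj h p v = v}
      zero_mem' := ⟨∅, by simp⟩
      add_mem' := by
        rintro a b ⟨S, hS⟩ ⟨T, hT⟩
        refine ⟨S ∪ T, fun T' hT' => ?_⟩
        simp only [map_add, Finset.sum_add_distrib]
        rw [hS _ (Finset.union_subset_left hT'), hT _ (Finset.union_subset_right hT')]
      smul_mem' := by
        rintro c a ⟨S, hS⟩
        refine ⟨S, fun T' hT' => ?_⟩
        simp only [map_smul, ← Finset.smul_sum]
        rw [hS _ hT'] }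
  have hD : v ∈ D := by
    refine internal_induction h D (fun p u hu => ⟨{p}, fun T' hT' => ?_⟩) v
    rw [Finset.sum_eq_single p, proj_same h hu]
    · exact fun q _ hq => proj_ne h hu hq.symm
    · exact fun hp => absurd (hT' (Finset.mem_singleton_self p)) hp
  obtain ⟨T, hT⟩ := hD
  rw [← hT T subset_rfl]
  exact Submodule.sum_mem _ fun p _ => hv p

theorem proj_of_lt {p q : ℤ} (hq : q < p) {a : V} (ha : a ∈ ⨆ r : Set.Iic q, G r) :
    proj h p a = 0 := by
  have : ⨆ r : Set.Iic q, G r ≤ LinearMap.ker (proj h p) :=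
    iSup_le fun r x hx => proj_ne h hx (by have : r.1 ≤ q := r.2; lia)
  exact this ha

theorem sub_proj_mem {p : ℤ} {a : V} (ha : a ∈ ⨆ r : Set.Iic p, G r) :
    a - proj h p a ∈ ⨆ r : Set.Iic (p - 1), G r := by
  have : ⨆ r : Set.Iic p, G r ≤
      (⨆ r : Set.Iic (p - 1), G r).comap (LinearMap.id - proj h p) := by
    refine iSup_le fun r x hx => ?_
    rw [Submodule.mem_comap, LinearMap.sub_apply, LinearMap.id_apply]
    rcases eq_or_ne r.1 p with hr | hr
    · rw [proj_same h (hr ▸ hx), sub_self]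
      exact Submodule.zero_mem _
    · rw [proj_ne h hx hr, sub_zero]
      exact Submodule.mem_iSup_of_mem
        (⟨r.1, by have : r.1 ≤ p := r.2; exact Set.mem_Iic.2 (by lia)⟩ : Set.Iic (p - 1)) hx
  exact this ha

theorem mem_iSup_Iic {p q : ℤ} (hq : q ≤ p) {a : V} (ha : a ∈ G q) : a ∈ ⨆ r : Set.Iic p, G r :=
  Submodule.mem_iSup_of_mem (⟨q, hq⟩ : Set.Iic p) ha

variable {A : Type*} [AddCommGroup A] [Module ℂ A]

/-- `σ : V → gr A` is the symbol map of the filtration of `A` that is the image under `s : V → A` of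
the filtration of `V` given by the grading `G`. -/
structure IsSymbolMap (G : ℤ → Submodule ℂ V) (s : V →ₗ[ℂ] A) (F : ℤ → Submodule ℂ A)
    (σ : V →ₗ[ℂ] Gr F) : Prop where
  fil : ∀ p, F p = (⨆ q : Set.Iic p, G q).map s
  apply : ∀ p u, u ∈ G p → ∃ hs, σ u = symb F p ⟨s u, hs⟩

/-- The symbol map of a filtration. -/
def symbolMap (s : V →ₗ[ℂ] A) (F : ℤ → Submodule ℂ A)
    (hF : ∀ p, F p = (⨆ q : Set.Iic p, G q).map s) : V →ₗ[ℂ] Gr F :=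
  glue h fun p => symb F p ∘ₗ s.restrict fun u hu => by
    rw [hF]
    exact Submodule.mem_map_of_mem (mem_iSup_Iic le_rfl hu)

theorem isSymbolMap_symbolMap (s : V →ₗ[ℂ] A) (F : ℤ → Submodule ℂ A)
    (hF : ∀ p, F p = (⨆ q : Set.Iic p, G q).map s) : IsSymbolMap G s F (symbolMap h s F hF) := by
  refine ⟨hF, fun p u hu => ⟨?_, ?_⟩⟩
  · rw [hF]
    exact Submodule.mem_map_of_mem (mem_iSup_Iic le_rfl hu)
  · rw [symbolMap, glue_apply _ _ hu]
    rfl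

theorem symb_eq_symb (F : ℤ → Submodule ℂ A) (p : ℤ) (x y : F p) (hxy : (x - y : A) ∈ F (p - 1)) :
    symb F p x = symb F p y := by
  rw [← sub_eq_zero, ← map_sub]
  exact symb_eq_zero F p _ hxy

theorem exists_symb_induction {F : ℤ → Submodule ℂ A} (S : Submodule ℂ (Gr F))
    (hS : ∀ p x, symb F p x ∈ S) (y : Gr F) : y ∈ S := by
  classical
  induction y using DirectSum.induction_on with
  | zero => exact S.zero_mem
  | of p x =>
    obtain ⟨x, rfl⟩ := Submodule.mkQ_surjective _ x
    exact hS p x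
  | add a b ha hb => exact S.add_mem ha hb

namespace IsSymbolMap

variable {s : V →ₗ[ℂ] A} {F : ℤ → Submodule ℂ A} {σ : V →ₗ[ℂ] Gr F}

theorem mem_fil (hσ : IsSymbolMap G s F σ) {p : ℤ} {a : V} (ha : a ∈ ⨆ r : Set.Iic p, G r) :
    s a ∈ F p := by
  rw [hσ.fil]
  exact Submodule.mem_map_of_mem ha

/-- The symbol of `s a` is that of the leading component of `a`. -/
theorem symb_eq (hσ : IsSymbolMap G s F σ) {p : ℤ} {a : V} (ha : a ∈ ⨆ r : Set.Iic p, G r)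
    (hs : s a ∈ F p) : symb F p ⟨s a, hs⟩ = σ (proj h p a) := by
  obtain ⟨h', e⟩ := hσ.apply p _ (proj_mem h p a)
  rw [e]
  refine symb_eq_symb _ _ _ _ ?_
  simp only
  rw [← map_sub]
  exact hσ.mem_fil (sub_proj_mem h ha)

theorem surjective (hσ : IsSymbolMap G s F σ) (h : DirectSum.IsInternal G) :
    Function.Surjective σ := by
  intro y
  refine exists_symb_induction (LinearMap.range σ) (fun p x => ?_) y
  obtain ⟨x, hx⟩ := x
  have hx' := hx
  rw [hσ.fil] at hx'
  obtain ⟨a, ha, rfl⟩ := hx'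
  exact ⟨_, (hσ.symb_eq h ha hx).symm⟩

/-- The `p`-th component of `σ v` is the class of `s` of the `p`-th component of `v`, as is seen on
homogeneous vectors. -/
theorem eq_zero_iff (hσ : IsSymbolMap G s F σ) (v : V) :
    σ v = 0 ↔ ∀ p, s (proj h p v) ∈ F (p - 1) := by
  constructor
  · intro hv p
    let c : Gr F →ₗ[ℂ] F p ⧸ (F (p - 1)).submoduleOf (F p) := DirectSum.component ℂ ℤ _ p
    have hF : ∀ v, s (proj h p v) ∈ F p := fun v => by
      rw [hσ.fil]
      exact Submodule.mem_map_of_mem (mem_iSup_Iic le_rfl (proj_mem h p v))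
    have key : v ∈ LinearMap.eqLocus (c ∘ₗ σ)
        (Submodule.mkQ _ ∘ₗ (s ∘ₗ proj h p).codRestrict (F p) hF) := by
      refine internal_induction h _ (fun q u hu => ?_) v
      obtain ⟨h', e⟩ := hσ.apply q u hu
      rw [LinearMap.mem_eqLocus, LinearMap.comp_apply, e]
      change DirectSum.component ℂ ℤ (fun p => F p ⧸ (F (p - 1)).submoduleOf (F p)) p
        (DirectSum.lof ℂ ℤ (fun p => F p ⧸ (F (p - 1)).submoduleOf (F p)) q (Submodule.mkQ _ ⟨s u, h'⟩)) = _
      rcases eq_or_ne q p with rfl | hq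
      · rw [DirectSum.component.lof_self, LinearMap.comp_apply]
        congr 1
        exact Subtype.ext (congrArg s (proj_same h hu).symm)
      · rw [DirectSum.component.of, dif_neg hq, LinearMap.comp_apply, eq_comm]
        refine (Submodule.Quotient.mk_eq_zero _).2 ?_
        change s (proj h p u) ∈ F (p - 1)
        rw [proj_ne h hu hq, map_zero]
        exact Submodule.zero_mem _
    rw [LinearMap.mem_eqLocus, LinearMap.comp_apply, hv, map_zero, eq_comm] at key
    exact (Submodule.Quotient.mk_eq_zero ((F (p - 1)).submoduleOf (F p))).1 key
  · intro hv
    refine mem_of_proj_mem h (LinearMap.ker σ) fun p => ?_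
    obtain ⟨h', e⟩ := hσ.apply p _ (proj_mem h p v)
    rw [LinearMap.mem_ker, e]
    exact symb_eq_zero _ _ _ (hv p)

/-- The kernel of a symbol map is graded by the grading that defines the filtration, even if the
kernel of `s` is not. -/
theorem map_proj_eq_zero (hσ : IsSymbolMap G s F σ) {v : V} (hv : σ v = 0) (p : ℤ) :
    σ (proj h p v) = 0 := by
  rw [hσ.eq_zero_iff h] at *
  intro q
  rcases eq_or_ne p q with rfl | hq
  · rw [proj_same h (proj_mem h p v)]
    exact hv p
  · rw [proj_ne h (proj_mem h p v) hq, map_zero]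
    exact Submodule.zero_mem _

theorem eq_zero_iff_of_mem (hσ : IsSymbolMap G s F σ) (h : DirectSum.IsInternal G) {p : ℤ} {v : V}
    (hv : v ∈ G p) : σ v = 0 ↔ s v ∈ F (p - 1) := by
  rw [hσ.eq_zero_iff h]
  constructor
  · intro h0
    simpa [proj_same h hv] using h0 p
  · intro h0 q
    rcases eq_or_ne p q with rfl | hq
    · rwa [proj_same h hv]
    · rw [proj_ne h hv hq, map_zero]
      exact Submodule.zero_mem _

/-- If the kernel of `s` is graded, then it is the kernel of the symbol map. -/
theorem ker_eq (hσ : IsSymbolMap G s F σ) (hs : ∀ v p, s v = 0 → s (proj h p v) = 0) :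
    LinearMap.ker σ = LinearMap.ker s := by
  ext v
  rw [LinearMap.mem_ker, hσ.eq_zero_iff h]
  constructor
  · intro hv
    refine mem_of_proj_mem h (LinearMap.ker s) fun p => ?_
    have hv' := hv p
    rw [hσ.fil] at hv'
    obtain ⟨a, ha, e⟩ := hv'
    -- Here `a` lies below `p`, so the `p`-th component of this element of the graded kernel is that
    -- of `v` itself.
    have h0 := hs (proj h p v - a) p (by rw [map_sub, e, sub_self])
    rwa [map_sub, proj_same h (proj_mem h p v), proj_of_lt h (by lia) ha, sub_zero] at h0
  · intro hv p
    rw [hs v p hv]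
    exact Submodule.zero_mem _

/-- The classes in `gr A` of the elements of `F_p` that come from a graded subspace `H`. -/
theorem map_piece (hσ : IsSymbolMap G s F σ) (hs : ∀ v p, s v = 0 → s (proj h p v) = 0)
    (H : Submodule ℂ V) (hH : ∀ v p, v ∈ H → proj h p v ∈ H) (p : ℤ) :
    (((H.map s).comap (F p).subtype).map (symb F p)) = (H ⊓ G p).map σ := by
  apply le_antisymm
  · rintro _ ⟨⟨y, hy⟩, ⟨v, hv, e⟩, rfl⟩
    have hy' := hy
    rw [hσ.fil] at hy'
    obtain ⟨a, ha, rfl⟩ := hy'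
    refine ⟨proj h p v, ⟨hH v p hv, proj_mem h p v⟩, ?_⟩
    rw [hσ.symb_eq h ha hy, ← sub_eq_zero, ← map_sub, ← map_sub, ← LinearMap.mem_ker,
      hσ.ker_eq h hs]
    exact hs _ p (by rw [map_sub, sub_eq_zero]; exact e)
  · rintro _ ⟨v, ⟨hv, hvp⟩, rfl⟩
    obtain ⟨h', e⟩ := hσ.apply p v hvp
    rw [e]
    exact ⟨_, Submodule.mem_map_of_mem (f := s) hv, rfl⟩

theorem map_grade (hσ : IsSymbolMap G s F σ) (h : DirectSum.IsInternal G) (p : ℤ) :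
    (G p).map σ = LinearMap.range (symb F p) := by
  apply le_antisymm
  · rintro _ ⟨v, hv, rfl⟩
    obtain ⟨h', e⟩ := hσ.apply p v hv
    exact ⟨_, e.symm⟩
  · rintro _ ⟨⟨y, hy⟩, rfl⟩
    have hy' := hy
    rw [hσ.fil] at hy'
    obtain ⟨a, ha, rfl⟩ := hy'
    exact ⟨_, proj_mem h p a, (hσ.symb_eq h ha hy).symm⟩

/-- Identifies `(gr_* ψ)_V` and `(gr^[*] φ)_V` with maps under `V`, which turns statements about
them into statements about symbol maps. -/
theorem grMap_comp (hσ : IsSymbolMap G s F σ) (h : DirectSum.IsInternal G)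
    {B : Type*} [AddCommGroup B] [Module ℂ B] {t : V →ₗ[ℂ] B} {F' : ℤ → Submodule ℂ B}
    {σ' : V →ₗ[ℂ] Gr F'} (hσ' : IsSymbolMap G t F' σ') (f : A →ₗ[ℂ] B) (hf : ∀ v, f (s v) = t v)
    (hF : ∀ p, (F p).map f ≤ F' p) (v : V) : grMap f hF (σ v) = σ' v := by
  refine internal_induction h (LinearMap.eqLocus (grMap f hF ∘ₗ σ) σ') (fun p u hu => ?_) v
  obtain ⟨h1, e1⟩ := hσ.apply p u hu
  obtain ⟨h2, e2⟩ := hσ'.apply p u hu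
  rw [LinearMap.mem_eqLocus, LinearMap.comp_apply, e1, e2]
  change DirectSum.lmap _
    (DirectSum.lof ℂ ℤ (fun p => F p ⧸ (F (p - 1)).submoduleOf (F p)) p (Submodule.mkQ _ ⟨s u, h1⟩)) = _
  rw [DirectSum.lmap_lof]
  change DirectSum.lof ℂ ℤ (fun p => F' p ⧸ (F' (p - 1)).submoduleOf (F' p)) p (Submodule.mkQ _ ⟨f (s u), _⟩) =
    DirectSum.lof ℂ ℤ (fun p => F' p ⧸ (F' (p - 1)).submoduleOf (F' p)) p (Submodule.mkQ _ ⟨t u, h2⟩)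
  congr 2
  exact Subtype.ext (hf u)

end IsSymbolMap

end Proj

/-! ### Descending maps along surjections from `V` -/

section Descend

variable {V X Y : Type*} [AddCommGroup V] [Module ℂ V] [AddCommGroup X] [Module ℂ X]
  [AddCommGroup Y] [Module ℂ Y]

theorem exists_descend {s : V →ₗ[ℂ] X} {t : V →ₗ[ℂ] Y} (hs : Function.Surjective s)
    (f : V →ₗ[ℂ] V) (hf : ∀ v, s v = 0 → t (f v) = 0) :
    ∃ g : X →ₗ[ℂ] Y, ∀ v, g (s v) = t (f v) := by
  obtain ⟨s', hs'⟩ := s.exists_rightInverse_of_surjective (LinearMap.range_eq_top.2 hs)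
  refine ⟨t ∘ₗ f ∘ₗ s', fun v => ?_⟩
  have h := hf (s' (s v) - v) (by
    rw [map_sub, sub_eq_zero]
    exact LinearMap.congr_fun hs' (s v))
  rwa [map_sub, map_sub, sub_eq_zero] at h

/-- The operation is computed on linear sections of `s` and `t`; the two vanishing hypotheses make
the choice irrelevant. -/
theorem exists_descend₂ {s : V →ₗ[ℂ] X} {t : V →ₗ[ℂ] Y} (hs : Function.Surjective s)
    (ht : Function.Surjective t) (f : V →ₗ[ℂ] V →ₗ[ℂ] V) (h₁ : ∀ u v, s u = 0 → t (f u v) = 0)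
    (h₂ : ∀ u v, t v = 0 → t (f u v) = 0) :
    ∃ g : X →ₗ[ℂ] Y →ₗ[ℂ] Y, ∀ u v, g (s u) (t v) = t (f u v) := by
  obtain ⟨s', hs'⟩ := s.exists_rightInverse_of_surjective (LinearMap.range_eq_top.2 hs)
  obtain ⟨t', ht'⟩ := t.exists_rightInverse_of_surjective (LinearMap.range_eq_top.2 ht)
  refine ⟨(f.compl₁₂ s' t').compr₂ t, fun u v => ?_⟩
  have e1 := h₁ (s' (s u) - u) (t' (t v)) (by
    rw [map_sub, sub_eq_zero]
    exact LinearMap.congr_fun hs' (s u))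
  have e2 := h₂ u (t' (t v) - v) (by
    rw [map_sub, sub_eq_zero]
    exact LinearMap.congr_fun ht' (t v))
  rw [map_sub, LinearMap.sub_apply, map_sub, sub_eq_zero] at e1
  rw [map_sub, map_sub, sub_eq_zero] at e2
  exact e1.trans e2

end Descend

namespace DGVertexOperatorAlgebra

variable {V : Type*} [AddCommGroup V] [Module ℂ V] (𝒱 : DGVertexOperatorAlgebra V)

/-! ### Bigraded projections -/

open Classical in
/-- The projection of `V` to the sum of the bihomogeneous components whose indices satisfy `Q`. -/
def biProj (Q : ℤ → ℤ → Prop) : V →ₗ[ℂ] V :=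
  glue 𝒱.weight_internal' fun k =>
    (glue 𝒱.deg_internal fun p => if Q p k then (𝒱.deg p).subtype else 0) ∘ₗ (𝒱.weight k).subtype

theorem biProj_pos {Q : ℤ → ℤ → Prop} {p k : ℤ} {u : V} (hp : u ∈ 𝒱.deg p) (hk : u ∈ 𝒱.weight k)
    (hQ : Q p k) : 𝒱.biProj Q u = u := by
  rw [biProj, glue_apply _ _ hk, LinearMap.comp_apply, Submodule.subtype_apply,
    glue_apply _ _ hp, if_pos hQ]
  rfl

theorem biProj_neg {Q : ℤ → ℤ → Prop} {p k : ℤ} {u : V} (hp : u ∈ 𝒱.deg p) (hk : u ∈ 𝒱.weight k)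
    (hQ : ¬ Q p k) : 𝒱.biProj Q u = 0 := by
  rw [biProj, glue_apply _ _ hk, LinearMap.comp_apply, Submodule.subtype_apply,
    glue_apply _ _ hp, if_neg hQ]
  rfl

theorem bihom_ext {X : Type*} [AddCommGroup X] [Module ℂ X] {f g : V →ₗ[ℂ] X}
    (h : ∀ p k u, u ∈ 𝒱.deg p → u ∈ 𝒱.weight k → f u = g u) : f = g :=
  LinearMap.ext fun v => 𝒱.bihom_induction (LinearMap.eqLocus f g) h v

theorem biProj_biProj (P Q : ℤ → ℤ → Prop) (v : V) :
    𝒱.biProj P (𝒱.biProj Q v) = 𝒱.biProj (fun p k => P p k ∧ Q p k) v := by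
  refine LinearMap.congr_fun (f := 𝒱.biProj P ∘ₗ 𝒱.biProj Q)
    (𝒱.bihom_ext fun p k u hp hk => ?_) v
  rw [LinearMap.comp_apply]
  by_cases hQ : Q p k
  · rw [𝒱.biProj_pos hp hk hQ]
    by_cases hP : P p k
    · rw [𝒱.biProj_pos hp hk hP, 𝒱.biProj_pos hp hk ⟨hP, hQ⟩]
    · rw [𝒱.biProj_neg hp hk hP, 𝒱.biProj_neg hp hk (fun h => hP h.1)]
  · rw [𝒱.biProj_neg hp hk hQ, map_zero, 𝒱.biProj_neg hp hk (fun h => hQ h.2)]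

theorem biProj_add_biProj_not (Q : ℤ → ℤ → Prop) (v : V) :
    𝒱.biProj Q v + 𝒱.biProj (fun p k => ¬ Q p k) v = v := by
  refine LinearMap.congr_fun (f := 𝒱.biProj Q + 𝒱.biProj (fun p k => ¬ Q p k))
    (g := LinearMap.id) (𝒱.bihom_ext fun p k u hp hk => ?_) v
  rw [LinearMap.add_apply, LinearMap.id_apply]
  by_cases hQ : Q p k
  · rw [𝒱.biProj_pos hp hk hQ, 𝒱.biProj_neg hp hk (not_not.2 hQ), add_zero]
  · rw [𝒱.biProj_neg hp hk hQ, 𝒱.biProj_pos hp hk hQ, zero_add]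

/-- The sum of the bihomogeneous components whose indices satisfy `Q`. -/
def biSupp (Q : ℤ → ℤ → Prop) : Submodule ℂ V := LinearMap.eqLocus (𝒱.biProj Q) LinearMap.id

theorem mem_biSupp {Q : ℤ → ℤ → Prop} {v : V} : v ∈ 𝒱.biSupp Q ↔ 𝒱.biProj Q v = v := Iff.rfl

theorem mem_biSupp_of_bihom {Q : ℤ → ℤ → Prop} {p k : ℤ} {u : V} (hp : u ∈ 𝒱.deg p)
    (hk : u ∈ 𝒱.weight k) (hQ : Q p k) : u ∈ 𝒱.biSupp Q := 𝒱.biProj_pos hp hk hQ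

theorem biProj_mem_biSupp {P Q R : ℤ → ℤ → Prop} {v : V} (hv : v ∈ 𝒱.biSupp P)
    (h : ∀ p k, Q p k → P p k → R p k) : 𝒱.biProj Q v ∈ 𝒱.biSupp R := by
  rw [mem_biSupp] at *
  rw [biProj_biProj, ← hv, biProj_biProj, biProj_biProj]
  congr 2
  ext p k
  exact ⟨fun hx => ⟨hx.1.2, hx.2⟩, fun hx => ⟨⟨h p k hx.1 hx.2, hx.1⟩, hx.2⟩⟩

theorem biSupp_mono {P R : ℤ → ℤ → Prop} (h : ∀ p k, P p k → R p k) :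
    𝒱.biSupp P ≤ 𝒱.biSupp R := by
  intro v hv
  rw [← 𝒱.mem_biSupp.1 hv]
  exact 𝒱.biProj_mem_biSupp hv fun p k _ hp => h p k hp

theorem biSupp_le {Q : ℤ → ℤ → Prop} {S : Submodule ℂ V}
    (h : ∀ p k u, Q p k → u ∈ 𝒱.deg p → u ∈ 𝒱.weight k → u ∈ S) : 𝒱.biSupp Q ≤ S := by
  intro v hv
  rw [← 𝒱.mem_biSupp.1 hv]
  refine 𝒱.bihom_induction (S.comap (𝒱.biProj Q)) (fun p k u hp hk => ?_) v
  rw [Submodule.mem_comap]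
  by_cases hQ : Q p k
  · rw [𝒱.biProj_pos hp hk hQ]
    exact h p k u hQ hp hk
  · rw [𝒱.biProj_neg hp hk hQ]
    exact S.zero_mem

theorem proj_deg (p : ℤ) (v : V) :
    proj 𝒱.deg_internal p v = 𝒱.biProj (fun q _ => q = p) v := by
  refine LinearMap.congr_fun (𝒱.bihom_ext fun q k u hq hk => ?_) v
  rcases eq_or_ne q p with rfl | h
  · rw [proj_same _ hq, 𝒱.biProj_pos hq hk rfl]
  · rw [proj_ne _ hq h, 𝒱.biProj_neg hq hk h]

theorem proj_weight (k : ℤ) (v : V) :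
    proj 𝒱.weight_internal' k v = 𝒱.biProj (fun _ l => l = k) v := by
  refine LinearMap.congr_fun (𝒱.bihom_ext fun q l u hq hl => ?_) v
  rcases eq_or_ne l k with rfl | h
  · rw [proj_same _ hl, 𝒱.biProj_pos hq hl rfl]
  · rw [proj_ne _ hl h, 𝒱.biProj_neg hq hl h]

theorem deg_eq (p : ℤ) : 𝒱.deg p = 𝒱.biSupp fun q _ => q = p := by
  refine le_antisymm (fun u hu => ?_) (𝒱.biSupp_le fun q k u h hq _ => h ▸ hq)
  rw [mem_biSupp, ← proj_deg, proj_same _ hu]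

theorem weight_eq (k : ℤ) : 𝒱.weight k = 𝒱.biSupp fun _ l => l = k := by
  refine le_antisymm (fun u hu => ?_) (𝒱.biSupp_le fun q l u h _ hl => h ▸ hl)
  rw [mem_biSupp, ← proj_weight, proj_same _ hu]

theorem degFil_eq (p : ℤ) : 𝒱.degFil p = 𝒱.biSupp fun q _ => q ≤ p := by
  refine le_antisymm (iSup_le fun q => ?_) (𝒱.biSupp_le fun q k u h hq _ => 𝒱.deg_le_of h hq)
  rw [deg_eq]
  exact 𝒱.biSupp_mono fun r _ hr => hr.trans_le q.2

theorem weightFil_eq (k : ℤ) : 𝒱.weightFil k = 𝒱.biSupp fun _ l => l ≤ k := by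
  refine le_antisymm (iSup_le fun q => ?_) (𝒱.biSupp_le fun q l u h _ hl => 𝒱.weight_le_of h hl)
  rw [weight_eq]
  exact 𝒱.biSupp_mono fun _ r hr => hr.trans_le q.2

/-- `O(V)` is graded by the difference of the degree and twice the weight. -/
theorem biProj_mem_zhuO (Q : ℤ → Prop) {o : V} (ho : o ∈ 𝒱.zhuO) :
    𝒱.biProj (fun p k => Q (p - k)) o ∈ 𝒱.zhuO := by
  refine 𝒱.zhuO_le (𝒱.zhuO.comap (𝒱.biProj fun p k => Q (p - k)))
    (fun p k q l u v hp hk hq hl => ?_) ho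
  obtain ⟨N, hN⟩ := (𝒱.eventually_res ((k : ℂ) / 2) (-2) u v).exists
  have hO : 𝒱.circ k u v ∈ 𝒱.zhuO := Submodule.subset_span ⟨k, u, v, hk, rfl⟩
  -- The mode enters the degree and the doubled weight identically, so the difference does not
  -- depend on the term of `u ∘ v`.
  have he : ∀ i : ℕ, p + q - 2 * ((i : ℤ) + -2) - 2 - (k + l - 2 * ((i : ℤ) + -2) - 2) =
      p + q - k - l := fun i => by ring
  rw [Submodule.mem_comap]
  by_cases hQ : Q (p + q - k - l)
  · suffices h : 𝒱.biProj (fun p k => Q (p - k)) (𝒱.circ k u v) = 𝒱.circ k u v by rwa [h]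
    rw [circ, hN, map_sum]
    refine sum_congr rfl fun i _ => ?_
    rw [map_smul, 𝒱.biProj_pos (𝒱.prod_deg p q _ u v hp hq) (𝒱.prod_weight hp hk hl)]
    rwa [he]
  · suffices h : 𝒱.biProj (fun p k => Q (p - k)) (𝒱.circ k u v) = 0 by
      rw [h]
      exact Submodule.zero_mem _
    rw [circ, hN, map_sum]
    refine sum_eq_zero fun i _ => ?_
    rw [map_smul, 𝒱.biProj_neg (𝒱.prod_deg p q _ u v hp hq) (𝒱.prod_weight hp hk hl), smul_zero]
    rwa [he]

theorem zhuMk_eq_iff {x y : V} : 𝒱.zhuMk x = 𝒱.zhuMk y ↔ x - y ∈ 𝒱.zhuO :=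
  Submodule.Quotient.eq _

theorem zhuMk_biProj (Q : ℤ → Prop) {x y : V} (h : 𝒱.zhuMk x = 𝒱.zhuMk y) :
    𝒱.zhuMk (𝒱.biProj (fun p k => Q (p - k)) x) =
      𝒱.zhuMk (𝒱.biProj (fun p k => Q (p - k)) y) := by
  rw [zhuMk_eq_iff] at *
  rw [← map_sub]
  exact 𝒱.biProj_mem_zhuO Q h

/-- `F^p A(V) ∩ W_n A(V)` is the image of `F^p V ∩ W_n V`. -/
theorem zhuF_inf_zhuW (p k : ℤ) :
    𝒱.zhuF p ⊓ 𝒱.zhuW k = (𝒱.biSupp fun q l => q ≤ p ∧ l ≤ k).map 𝒱.zhuMk := by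
  apply le_antisymm
  · rintro x ⟨⟨a, ha, rfl⟩, ⟨b, hb, hab⟩⟩
    rw [SetLike.mem_coe, degFil_eq] at ha
    rw [SetLike.mem_coe, weightFil_eq] at hb
    -- Splice two representatives along the difference grading. Where `q - l ≥ p - k`, the bound `q
    -- ≤ p` forces `l ≤ k`, so `a` is good; elsewhere `l ≤ k` forces `q < p`, so `b` is good.
    -- Classes agree because `O(V)` is graded by the difference.
    refine ⟨𝒱.biProj (fun q l => p - k ≤ q - l) a + 𝒱.biProj (fun q l => ¬ p - k ≤ q - l) b,
      Submodule.add_mem _ (𝒱.biProj_mem_biSupp ha ?_) (𝒱.biProj_mem_biSupp hb ?_), ?_⟩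
    · intro q l h1 h2
      exact ⟨h2, by lia⟩
    · intro q l h1 h2
      exact ⟨by lia, h2⟩
    · rw [← hab, map_add, 𝒱.zhuMk_biProj (fun e => p - k ≤ e) hab.symm, ← map_add,
        𝒱.biProj_add_biProj_not fun q l => p - k ≤ q - l]
  · rw [zhuF, zhuW, degFil_eq, weightFil_eq]
    exact le_inf (Submodule.map_mono (𝒱.biSupp_mono fun _ _ h => h.1))
      (Submodule.map_mono (𝒱.biSupp_mono fun _ _ h => h.2))

/-! ### The common kernel of the symbol maps -/

theorem isSymbolMap_sigmaF : IsSymbolMap 𝒱.deg 𝒱.zhuMk 𝒱.zhuF 𝒱.sigmaF :=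
  ⟨fun _ => rfl, fun _ _ hu => ⟨_, 𝒱.sigmaF_apply hu⟩⟩

theorem isSymbolMap_sigmaW : IsSymbolMap 𝒱.weight 𝒱.zhuMk 𝒱.zhuW 𝒱.sigmaW :=
  ⟨fun _ => rfl, fun _ _ hu => ⟨_, 𝒱.sigmaW_apply hu⟩⟩

/-- A lower representative may be projected to the difference `p - k` of `u`; there, degree below
`p` and doubled weight below `k` mean the same. This is where the two filtrations are matched. -/
theorem zhuMk_mem_F_iff {p k : ℤ} {u : V} (hp : u ∈ 𝒱.deg p) (hk : u ∈ 𝒱.weight k) :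
    𝒱.zhuMk u ∈ 𝒱.zhuF (p - 1) ↔ 𝒱.zhuMk u ∈ 𝒱.zhuW (k - 1) := by
  have hu : 𝒱.biProj (fun q l => q - l = p - k) u = u := 𝒱.biProj_pos hp hk rfl
  constructor
  · rintro ⟨a, ha, hau⟩
    rw [SetLike.mem_coe, degFil_eq] at ha
    rw [← hu, ← 𝒱.zhuMk_biProj (fun e => e = p - k) hau, zhuW, weightFil_eq]
    exact Submodule.mem_map_of_mem (𝒱.biProj_mem_biSupp ha fun q l h1 h2 => by lia)
  · rintro ⟨a, ha, hau⟩
    rw [SetLike.mem_coe, weightFil_eq] at ha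
    rw [← hu, ← 𝒱.zhuMk_biProj (fun e => e = p - k) hau, zhuF, degFil_eq]
    exact Submodule.mem_map_of_mem (𝒱.biProj_mem_biSupp ha fun q l h1 h2 => by lia)

theorem sigmaF_eq_zero_iff_sigmaW {p k : ℤ} {u : V} (hp : u ∈ 𝒱.deg p) (hk : u ∈ 𝒱.weight k) :
    𝒱.sigmaF u = 0 ↔ 𝒱.sigmaW u = 0 := by
  rw [𝒱.isSymbolMap_sigmaF.eq_zero_iff_of_mem 𝒱.deg_internal hp,
    𝒱.isSymbolMap_sigmaW.eq_zero_iff_of_mem 𝒱.weight_internal' hk, 𝒱.zhuMk_mem_F_iff hp hk]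

theorem proj_comm (p k : ℤ) (v : V) :
    proj 𝒱.deg_internal p (proj 𝒱.weight_internal' k v) =
      proj 𝒱.weight_internal' k (proj 𝒱.deg_internal p v) := by
  simp only [proj_deg, proj_weight, biProj_biProj, and_comm]

/-- On a vector of degree `p`, projecting to weight index `k` is projecting to the difference `p -
k`, and the latter preserves `O(V)` and the degree filtration. -/
theorem sigmaF_proj_weight {v : V} (hv : 𝒱.sigmaF v = 0) (k : ℤ) :
    𝒱.sigmaF (proj 𝒱.weight_internal' k v) = 0 := by
  refine mem_of_proj_mem 𝒱.deg_internal (LinearMap.ker 𝒱.sigmaF) fun p => ?_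
  have h1 := 𝒱.isSymbolMap_sigmaF.map_proj_eq_zero 𝒱.deg_internal hv p
  have hp := proj_mem 𝒱.deg_internal p v
  rw [𝒱.isSymbolMap_sigmaF.eq_zero_iff_of_mem 𝒱.deg_internal hp] at h1
  obtain ⟨a, ha, hau⟩ := h1
  rw [LinearMap.mem_ker, 𝒱.isSymbolMap_sigmaF.eq_zero_iff_of_mem 𝒱.deg_internal
    (proj_mem 𝒱.deg_internal p _), proj_comm]
  have e : proj 𝒱.weight_internal' k (proj 𝒱.deg_internal p v) =
      𝒱.biProj (fun q l => q - l = p - k) (proj 𝒱.deg_internal p v) := by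
    rw [proj_weight, proj_deg, biProj_biProj, biProj_biProj]
    congr 2
    ext q l
    constructor <;> rintro ⟨h1, h2⟩ <;> exact ⟨by lia, h2⟩
  rw [SetLike.mem_coe, degFil_eq] at ha
  rw [e, ← 𝒱.zhuMk_biProj (fun e => e = p - k) hau, zhuF, degFil_eq]
  exact Submodule.mem_map_of_mem (𝒱.biProj_mem_biSupp ha fun q l h1 h2 => h2)

theorem sigmaW_proj_deg {v : V} (hv : 𝒱.sigmaW v = 0) (p : ℤ) :
    𝒱.sigmaW (proj 𝒱.deg_internal p v) = 0 := by
  refine mem_of_proj_mem 𝒱.weight_internal' (LinearMap.ker 𝒱.sigmaW) fun k => ?_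
  have h1 := 𝒱.isSymbolMap_sigmaW.map_proj_eq_zero 𝒱.weight_internal' hv k
  have hk := proj_mem 𝒱.weight_internal' k v
  rw [𝒱.isSymbolMap_sigmaW.eq_zero_iff_of_mem 𝒱.weight_internal' hk] at h1
  obtain ⟨a, ha, hau⟩ := h1
  rw [LinearMap.mem_ker, 𝒱.isSymbolMap_sigmaW.eq_zero_iff_of_mem 𝒱.weight_internal'
    (proj_mem 𝒱.weight_internal' k _), ← proj_comm]
  have e : proj 𝒱.deg_internal p (proj 𝒱.weight_internal' k v) =
      𝒱.biProj (fun q l => q - l = p - k) (proj 𝒱.weight_internal' k v) := by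
    rw [proj_weight, proj_deg, biProj_biProj, biProj_biProj]
    congr 2
    ext q l
    constructor <;> rintro ⟨h1, h2⟩ <;> exact ⟨by lia, h2⟩
  rw [SetLike.mem_coe, weightFil_eq] at ha
  rw [e, ← 𝒱.zhuMk_biProj (fun e => e = p - k) hau, zhuW, weightFil_eq]
  exact Submodule.mem_map_of_mem (𝒱.biProj_mem_biSupp ha fun q l h1 h2 => h2)

theorem bihom_proj (p k : ℤ) (v : V) :
    proj 𝒱.weight_internal' k (proj 𝒱.deg_internal p v) ∈ 𝒱.deg p ∧
      proj 𝒱.weight_internal' k (proj 𝒱.deg_internal p v) ∈ 𝒱.weight k := by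
  refine ⟨?_, proj_mem _ _ _⟩
  rw [← proj_comm]
  exact proj_mem _ _ _

/-- Both kernels are bigraded, which reduces the comparison to bihomogeneous vectors. -/
theorem ker_sigmaW : LinearMap.ker 𝒱.sigmaW = LinearMap.ker 𝒱.sigmaF := by
  ext v
  constructor
  · intro hv
    refine mem_of_proj_mem 𝒱.deg_internal _ fun p => mem_of_proj_mem 𝒱.weight_internal' _ fun k => ?_
    rw [LinearMap.mem_ker,
      𝒱.sigmaF_eq_zero_iff_sigmaW (𝒱.bihom_proj p k v).1 (𝒱.bihom_proj p k v).2]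
    exact 𝒱.isSymbolMap_sigmaW.map_proj_eq_zero _ (𝒱.sigmaW_proj_deg hv p) k
  · intro hv
    refine mem_of_proj_mem 𝒱.deg_internal _ fun p => mem_of_proj_mem 𝒱.weight_internal' _ fun k => ?_
    rw [LinearMap.mem_ker,
      ← 𝒱.sigmaF_eq_zero_iff_sigmaW (𝒱.bihom_proj p k v).1 (𝒱.bihom_proj p k v).2]
    exact 𝒱.sigmaF_proj_weight (𝒱.isSymbolMap_sigmaF.map_proj_eq_zero _ hv p) k

theorem sigmaW_eq_zero_iff {v : V} : 𝒱.sigmaW v = 0 ↔ 𝒱.sigmaF v = 0 := by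
  rw [← LinearMap.mem_ker, ker_sigmaW, LinearMap.mem_ker]

theorem proj_deg_mem_weightFil {p k : ℤ} {c : V} (hc : c ∈ 𝒱.biSupp fun q l => q ≤ p ∧ l ≤ k) :
    proj 𝒱.deg_internal p c ∈ 𝒱.weightFil k := by
  rw [proj_deg, weightFil_eq]
  exact 𝒱.biProj_mem_biSupp hc fun q l _ h => h.2

theorem proj_weight_mem_degFil {p k : ℤ} {c : V} (hc : c ∈ 𝒱.biSupp fun q l => q ≤ p ∧ l ≤ k) :
    proj 𝒱.weight_internal' k c ∈ 𝒱.degFil p := by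
  rw [proj_weight, degFil_eq]
  exact 𝒱.biProj_mem_biSupp hc fun q l _ h => h.1

/-- An element of `F^p A(V) ∩ W_n A(V)` lifts to `F^p V ∩ W_n V` by `zhuF_inf_zhuW`, so its leading
degree component still lies in `W_n V`. This exhibits the double graded as a target of a symbol map
on `V`. -/
theorem inducedFil_zhuF_zhuW (k : ℤ) :
    inducedFil 𝒱.zhuF 𝒱.zhuW k = (𝒱.weightFil k).map 𝒱.sigmaF := by
  apply le_antisymm
  · refine iSup_le fun p => ?_
    rintro _ ⟨⟨x, hx⟩, hxk, rfl⟩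
    have hx' : x ∈ 𝒱.zhuF p ⊓ 𝒱.zhuW k := ⟨hx, hxk⟩
    rw [zhuF_inf_zhuW] at hx'
    obtain ⟨c, hc, rfl⟩ := hx'
    have hc' : c ∈ 𝒱.degFil p := by
      rw [degFil_eq]
      exact 𝒱.biSupp_mono (fun _ _ h => h.1) hc
    exact ⟨_, 𝒱.proj_deg_mem_weightFil hc, (𝒱.isSymbolMap_sigmaF.symb_eq 𝒱.deg_internal hc' hx).symm⟩
  · rw [weightFil_eq, Submodule.map_le_iff_le_comap]
    refine 𝒱.biSupp_le fun p l u hl hp hu => ?_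
    rw [Submodule.mem_comap, 𝒱.sigmaF_apply hp]
    exact Submodule.mem_iSup_of_mem p
      ⟨_, Submodule.mem_map_of_mem (𝒱.weight_le_of hl hu), rfl⟩

theorem inducedFil_zhuW_zhuF (p : ℤ) :
    inducedFil 𝒱.zhuW 𝒱.zhuF p = (𝒱.degFil p).map 𝒱.sigmaW := by
  apply le_antisymm
  · refine iSup_le fun k => ?_
    rintro _ ⟨⟨x, hx⟩, hxp, rfl⟩
    have hx' : x ∈ 𝒱.zhuF p ⊓ 𝒱.zhuW k := ⟨hxp, hx⟩
    rw [zhuF_inf_zhuW] at hx'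
    obtain ⟨c, hc, rfl⟩ := hx'
    have hc' : c ∈ 𝒱.weightFil k := by
      rw [weightFil_eq]
      exact 𝒱.biSupp_mono (fun _ _ h => h.2) hc
    exact ⟨_, 𝒱.proj_weight_mem_degFil hc,
      (𝒱.isSymbolMap_sigmaW.symb_eq 𝒱.weight_internal' hc' hx).symm⟩
  · rw [degFil_eq, Submodule.map_le_iff_le_comap]
    refine 𝒱.biSupp_le fun q k u hq hp hu => ?_
    rw [Submodule.mem_comap, 𝒱.sigmaW_apply hu]
    exact Submodule.mem_iSup_of_mem k
      ⟨_, Submodule.mem_map_of_mem (𝒱.deg_le_of hq hp), rfl⟩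

theorem isSymbolMap_sigmaWF :
    IsSymbolMap 𝒱.weight 𝒱.sigmaF (inducedFil 𝒱.zhuF 𝒱.zhuW) 𝒱.sigmaWF := by
  refine ⟨𝒱.inducedFil_zhuF_zhuW, fun k u hu => ⟨𝒱.sigmaF_mem hu, ?_⟩⟩
  rw [sigmaWF, glue_apply _ _ hu]
  rfl

/-- The linear map `V → gr^[*] gr_* A(V)` that sends `u ∈ V_n^[p]` to the class of `[u]`. -/
def sigmaFW : V →ₗ[ℂ] 𝒱.GrFW :=
  symbolMap 𝒱.deg_internal 𝒱.sigmaW (inducedFil 𝒱.zhuW 𝒱.zhuF) 𝒱.inducedFil_zhuW_zhuF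

theorem isSymbolMap_sigmaFW :
    IsSymbolMap 𝒱.deg 𝒱.sigmaW (inducedFil 𝒱.zhuW 𝒱.zhuF) 𝒱.sigmaFW :=
  isSymbolMap_symbolMap _ _ _ _

/-- The second passage to symbols loses nothing, the kernel of the first being graded by weight. -/
theorem sigmaWF_eq_zero_iff {v : V} : 𝒱.sigmaWF v = 0 ↔ 𝒱.sigmaF v = 0 := by
  rw [← LinearMap.mem_ker, 𝒱.isSymbolMap_sigmaWF.ker_eq 𝒱.weight_internal'
    fun v k hv => 𝒱.sigmaF_proj_weight hv k, LinearMap.mem_ker]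

theorem sigmaFW_eq_zero_iff {v : V} : 𝒱.sigmaFW v = 0 ↔ 𝒱.sigmaF v = 0 := by
  rw [← LinearMap.mem_ker, 𝒱.isSymbolMap_sigmaFW.ker_eq 𝒱.deg_internal
    fun v k hv => 𝒱.sigmaW_proj_deg hv k, ker_sigmaW, LinearMap.mem_ker]

theorem symb₂_eq {p k : ℤ} {c : V} (hc : c ∈ 𝒱.biSupp fun q l => q ≤ p ∧ l ≤ k)
    (h : 𝒱.zhuMk c ∈ 𝒱.zhuF p ⊓ 𝒱.zhuW k) : symb₂ 𝒱.zhuF 𝒱.zhuW p k ⟨𝒱.zhuMk c, h⟩ =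
      𝒱.sigmaWF (proj 𝒱.weight_internal' k (proj 𝒱.deg_internal p c)) := by
  have hc' : c ∈ 𝒱.degFil p := by
    rw [degFil_eq]
    exact 𝒱.biSupp_mono (fun _ _ h => h.1) hc
  have h1 := 𝒱.isSymbolMap_sigmaF.symb_eq 𝒱.deg_internal hc' h.1
  have h2 := 𝒱.proj_deg_mem_weightFil hc
  rw [← 𝒱.isSymbolMap_sigmaWF.symb_eq 𝒱.weight_internal' h2
    (𝒱.isSymbolMap_sigmaWF.mem_fil h2), symb₂, LinearMap.comp_apply]
  congr 1
  exact Subtype.ext h1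

theorem symb₂_eq' {p k : ℤ} {c : V} (hc : c ∈ 𝒱.biSupp fun q l => q ≤ p ∧ l ≤ k)
    (h : 𝒱.zhuMk c ∈ 𝒱.zhuW k ⊓ 𝒱.zhuF p) : symb₂ 𝒱.zhuW 𝒱.zhuF k p ⟨𝒱.zhuMk c, h⟩ =
      𝒱.sigmaFW (proj 𝒱.weight_internal' k (proj 𝒱.deg_internal p c)) := by
  have hc' : c ∈ 𝒱.weightFil k := by
    rw [weightFil_eq]
    exact 𝒱.biSupp_mono (fun _ _ h => h.2) hc
  have h1 := 𝒱.isSymbolMap_sigmaW.symb_eq 𝒱.weight_internal' hc' h.1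
  have h2 := 𝒱.proj_weight_mem_degFil hc
  rw [← proj_comm, ← 𝒱.isSymbolMap_sigmaFW.symb_eq 𝒱.deg_internal h2
    (𝒱.isSymbolMap_sigmaFW.mem_fil h2), symb₂, LinearMap.comp_apply]
  congr 1
  exact Subtype.ext h1

theorem map_sigmaWF (p k : ℤ) : (𝒱.deg p ⊓ 𝒱.weight k).map 𝒱.sigmaWF =
    LinearMap.range (symb₂ 𝒱.zhuF 𝒱.zhuW p k) := by
  apply le_antisymm
  · rintro _ ⟨u, hu, rfl⟩
    exact ⟨_, (𝒱.sigmaWF_apply hu.1 hu.2).symm⟩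
  · rintro _ ⟨⟨x, hx⟩, rfl⟩
    have hx' := hx
    rw [zhuF_inf_zhuW] at hx'
    obtain ⟨c, hc, rfl⟩ := hx'
    exact ⟨_, 𝒱.bihom_proj p k c, (𝒱.symb₂_eq hc hx).symm⟩

end DGVertexOperatorAlgebra

/-- Lets a full product such as `u * m` represent the symbol of its leading term `u_{-1} m`. -/
theorem IsSymbolMap.exists_eq_symb {V : Type*} [AddCommGroup V] [Module ℂ V]
    {G : ℤ → Submodule ℂ V} {A : Type*} [AddCommGroup A] [Module ℂ A] {s : V →ₗ[ℂ] A}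
    {F : ℤ → Submodule ℂ A} {σ : V →ₗ[ℂ] Gr F} (hσ : IsSymbolMap G s F σ) {p : ℤ} {u x : V}
    (hu : u ∈ G p) (hx : x - u ∈ ⨆ r : Set.Iic (p - 1), G r) :
    ∃ hs, σ u = symb F p ⟨s x, hs⟩ := by
  have hle : ⨆ r : Set.Iic (p - 1), G r ≤ ⨆ r : Set.Iic p, G r :=
    iSup_le fun r _ ha => mem_iSup_Iic (by have : r.1 ≤ p - 1 := r.2; lia) ha
  have hx' : s x ∈ F p := by
    refine hσ.mem_fil ?_
    rw [← sub_add_cancel x u]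
    exact Submodule.add_mem _ (hle hx) (mem_iSup_Iic le_rfl hu)
  obtain ⟨h', e⟩ := hσ.apply p u hu
  refine ⟨hx', e.trans (symb_eq_symb _ _ _ _ ?_)⟩
  rw [← neg_mem_iff, neg_sub, ← map_sub]
  exact hσ.mem_fil hx

namespace DGVertexOperatorAlgebra

variable {V : Type*} [AddCommGroup V] [Module ℂ V] (𝒱 : DGVertexOperatorAlgebra V)

/-! ### Leading terms of the operations -/

theorem prod_weight' {k l n : ℤ} {u v : V} (hu : u ∈ 𝒱.weight k) (hv : v ∈ 𝒱.weight l) :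
    𝒱.prod u n v ∈ 𝒱.weight (k + l - 2 * n - 2) := by
  have : 𝒱.weight k ≤ (𝒱.weight (k + l - 2 * n - 2)).comap ((𝒱.prodL n).flip v) :=
    (𝒱.weight_le_iSup k).trans (iSup_le fun p u hu => 𝒱.prod_weight hu.1 hu.2 hv)
  exact this hu

theorem prod_neg_one_deg {p q : ℤ} {u v : V} (hu : u ∈ 𝒱.deg p) (hv : v ∈ 𝒱.deg q) :
    𝒱.prod u (-1) v ∈ 𝒱.deg (p + q) := by
  have := 𝒱.prod_deg p q (-1) u v hu hv
  rwa [show p + q - 2 * (-1) - 2 = p + q by ring] at this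

theorem prod_zero_deg {p q : ℤ} {u v : V} (hu : u ∈ 𝒱.deg p) (hv : v ∈ 𝒱.deg q) :
    𝒱.prod u 0 v ∈ 𝒱.deg (p + q - 2) := by
  have := 𝒱.prod_deg p q 0 u v hu hv
  rwa [mul_zero, sub_zero] at this

theorem prod_neg_one_weight {k l : ℤ} {u v : V} (hu : u ∈ 𝒱.weight k) (hv : v ∈ 𝒱.weight l) :
    𝒱.prod u (-1) v ∈ 𝒱.weight (k + l) := by
  have := 𝒱.prod_weight' (n := -1) hu hv
  rwa [show k + l - 2 * (-1) - 2 = k + l by ring] at this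

theorem prod_zero_weight {k l : ℤ} {u v : V} (hu : u ∈ 𝒱.weight k) (hv : v ∈ 𝒱.weight l) :
    𝒱.prod u 0 v ∈ 𝒱.weight (k + l - 2) := by
  have := 𝒱.prod_weight' (n := 0) hu hv
  rwa [mul_zero, sub_zero] at this

theorem res_sub_prod (a : ℂ) (s : ℤ) (u v : V) : ∃ N, 𝒱.res a s u v - 𝒱.prod u s v =
    ∑ i ∈ range N, Ring.choose a (i + 1) • 𝒱.prod u ((i + 1 : ℕ) + s) v := by
  obtain ⟨N, hN⟩ := ((tendsto_add_atTop_nat 1).eventually (𝒱.eventually_res a s u v)).exists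
  refine ⟨N, ?_⟩
  rw [hN, sum_range_succ']
  simp

theorem res_sub_prod_mem_degFil {p q : ℤ} {u v : V} (hu : u ∈ 𝒱.deg p) (hv : v ∈ 𝒱.deg q) (a : ℂ)
    (s : ℤ) : 𝒱.res a s u v - 𝒱.prod u s v ∈ 𝒱.degFil (p + q - 2 * s - 2 - 1) := by
  obtain ⟨N, hN⟩ := 𝒱.res_sub_prod a s u v
  rw [hN]
  refine Submodule.sum_mem _ fun i _ => Submodule.smul_mem _ _
    (𝒱.deg_le_of ?_ (𝒱.prod_deg p q _ u v hu hv))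
  push_cast
  lia

theorem res_sub_prod_mem_weightFil {k l : ℤ} {u v : V} (hu : u ∈ 𝒱.weight k)
    (hv : v ∈ 𝒱.weight l) (a : ℂ) (s : ℤ) :
    𝒱.res a s u v - 𝒱.prod u s v ∈ 𝒱.weightFil (k + l - 2 * s - 2 - 1) := by
  obtain ⟨N, hN⟩ := 𝒱.res_sub_prod a s u v
  rw [hN]
  refine Submodule.sum_mem _ fun i _ => Submodule.smul_mem _ _
    (𝒱.weight_le_of ?_ (𝒱.prod_weight' hu hv))
  push_cast
  lia

/-- The two Koszul signs cancel, and the Pascal identity turns the difference of the residues with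
exponents `wt u` and `wt u - 1` into a residue with leading term `u_0 m`. -/
theorem comm_eq (k p q : ℤ) (u m : V) : 𝒱.comm k p q u m = 𝒱.res ((k : ℂ) / 2 - 1) 0 u m := by
  have h := 𝒱.res_add_one ((k : ℂ) / 2 - 1) (-1) u m
  rw [sub_add_cancel, neg_add_cancel] at h
  rw [comm, starL, starR, smul_smul, Int.units_mul_self, one_smul, h, add_sub_cancel_left]

theorem starL_sub_mem_degFil {p q : ℤ} {u v : V} (hu : u ∈ 𝒱.deg p) (hv : v ∈ 𝒱.deg q) (k : ℤ) :
    𝒱.starL k u v - 𝒱.prod u (-1) v ∈ 𝒱.degFil (p + q - 1) := by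
  have := 𝒱.res_sub_prod_mem_degFil hu hv ((k : ℂ) / 2) (-1)
  rwa [show p + q - 2 * (-1) - 2 - 1 = p + q - 1 by ring] at this

theorem comm_sub_mem_degFil {p q : ℤ} {u v : V} (hu : u ∈ 𝒱.deg p) (hv : v ∈ 𝒱.deg q) (k : ℤ) :
    𝒱.comm k p q u v - 𝒱.prod u 0 v ∈ 𝒱.degFil (p + q - 2 - 1) := by
  have := 𝒱.res_sub_prod_mem_degFil hu hv ((k : ℂ) / 2 - 1) 0
  rwa [mul_zero, sub_zero, ← comm_eq] at this

theorem starL_sub_mem_weightFil {k l : ℤ} {u v : V} (hu : u ∈ 𝒱.weight k) (hv : v ∈ 𝒱.weight l) :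
    𝒱.starL k u v - 𝒱.prod u (-1) v ∈ 𝒱.weightFil (k + l - 1) := by
  have := 𝒱.res_sub_prod_mem_weightFil hu hv ((k : ℂ) / 2) (-1)
  rwa [show k + l - 2 * (-1) - 2 - 1 = k + l - 1 by ring] at this

theorem comm_sub_mem_weightFil {k l : ℤ} {u v : V} (hu : u ∈ 𝒱.weight k) (hv : v ∈ 𝒱.weight l)
    (p q : ℤ) : 𝒱.comm k p q u v - 𝒱.prod u 0 v ∈ 𝒱.weightFil (k + l - 2 - 1) := by
  have := 𝒱.res_sub_prod_mem_weightFil hu hv ((k : ℂ) / 2 - 1) 0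
  rwa [mul_zero, sub_zero, ← comm_eq] at this

/-- The class of a vector in the double graded is that of its leading term. -/
theorem exists_sigmaWF_eq {p k : ℤ} {u x : V} (hp : u ∈ 𝒱.deg p) (hk : u ∈ 𝒱.weight k)
    (hF : x - u ∈ 𝒱.degFil (p - 1)) (hW : x - u ∈ 𝒱.weightFil (k - 1)) :
    ∃ h, 𝒱.sigmaWF u = symb₂ 𝒱.zhuF 𝒱.zhuW p k ⟨𝒱.zhuMk x, h⟩ := by
  rw [degFil_eq] at hF
  rw [weightFil_eq] at hW
  have hx : x - u ∈ 𝒱.biSupp fun q l => q ≤ p - 1 ∧ l ≤ k - 1 := by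
    rw [← 𝒱.mem_biSupp.1 hF]
    exact 𝒱.biProj_mem_biSupp hW fun q l h1 h2 => ⟨h1, h2⟩
  have hx' : x ∈ 𝒱.biSupp fun q l => q ≤ p ∧ l ≤ k := by
    rw [← sub_add_cancel x u]
    exact Submodule.add_mem _ (𝒱.biSupp_mono (fun q l h => ⟨by lia, by lia⟩) hx)
      (𝒱.mem_biSupp_of_bihom hp hk ⟨le_rfl, le_rfl⟩)
  have hm : 𝒱.zhuMk x ∈ 𝒱.zhuF p ⊓ 𝒱.zhuW k := by
    rw [zhuF_inf_zhuW]
    exact Submodule.mem_map_of_mem hx'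
  refine ⟨hm, ?_⟩
  rw [𝒱.symb₂_eq hx' hm]
  have h1 : proj 𝒱.deg_internal p (x - u) = 0 :=
    proj_of_lt 𝒱.deg_internal (q := p - 1) (by lia) (by
      change x - u ∈ 𝒱.degFil (p - 1)
      rwa [degFil_eq])
  rw [map_sub, sub_eq_zero, proj_same _ hp] at h1
  rw [h1, proj_same _ hk]

/-! ### The kernel of the symbol maps is a differential Poisson ideal -/

/-- If `a` is congruent modulo `O(V)` to some `r` of lower degree, then the corresponding operation
of `A(V)` gives congruent results on `a` and `r`. The result for `r` has lower degree, and the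
result for `a` differs from `a_s m` by terms of lower degree. -/
theorem sigmaF_prod_right {s : ℤ} (hs : s = -1 ∨ s = 0) {a : V} (ha : 𝒱.sigmaF a = 0) (m : V) :
    𝒱.sigmaF (𝒱.prod a s m) = 0 := by
  have key : a ∈ LinearMap.ker ((𝒱.prodL s).compr₂ 𝒱.sigmaF) := by
    refine mem_of_proj_mem 𝒱.deg_internal _ fun p => mem_of_proj_mem 𝒱.weight_internal' _ fun k => ?_
    obtain ⟨hp, hk⟩ := 𝒱.bihom_proj p k a
    have h0 := 𝒱.sigmaF_proj_weight (𝒱.isSymbolMap_sigmaF.map_proj_eq_zero 𝒱.deg_internal ha p) k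
    generalize proj 𝒱.weight_internal' k (proj 𝒱.deg_internal p a) = a at hp hk h0
    rw [LinearMap.mem_ker]
    refine 𝒱.bihom_ext fun q l m hq hl => ?_
    change 𝒱.sigmaF (𝒱.prod a s m) = 0
    obtain ⟨c, hc⟩ : ∃ c : ℂ, c = 0 ∧ s = -1 ∨ c = -1 ∧ s = 0 := by
      rcases hs with hs | hs
      · exact ⟨0, Or.inl ⟨rfl, hs⟩⟩
      · exact ⟨-1, Or.inr ⟨rfl, hs⟩⟩
    rw [𝒱.isSymbolMap_sigmaF.eq_zero_iff_of_mem 𝒱.deg_internal hp] at h0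
    rw [𝒱.isSymbolMap_sigmaF.eq_zero_iff_of_mem 𝒱.deg_internal (𝒱.prod_deg p q s a m hp hq)]
    obtain ⟨r, hr, e⟩ := h0
    have h1 := 𝒱.zhuOp_mem_zhuO hc (𝒱.zhuMk_eq_iff.1 e.symm) m
    rw [map_sub, LinearMap.sub_apply, ← zhuMk_eq_iff, 𝒱.zhuOp_apply c s hk] at h1
    have h2 : 𝒱.degFil (p - 1) ≤
        (𝒱.degFil (p + q - 2 * s - 2 - 1)).comap ((𝒱.zhuOp c s).flip m) := by
      rw [𝒱.degFil_eq (p - 1)]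
      refine 𝒱.biSupp_le fun p' k' u hle hu hu' => ?_
      rw [Submodule.mem_comap, LinearMap.flip_apply, 𝒱.zhuOp_apply c s hu']
      obtain ⟨N, hN⟩ := (𝒱.eventually_res ((k' : ℂ) / 2 + c) s u m).exists
      rw [hN]
      exact Submodule.sum_mem _ fun i _ => Submodule.smul_mem _ _
        (𝒱.deg_le_of (by lia) (𝒱.prod_deg p' q _ u m hu hq))
    change 𝒱.zhuMk (𝒱.prod a s m) ∈ 𝒱.zhuF (p + q - 2 * s - 2 - 1)
    rw [← sub_sub_cancel (𝒱.res ((k : ℂ) / 2 + c) s a m) (𝒱.prod a s m), map_sub, h1, ← map_sub]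
    exact Submodule.mem_map_of_mem (Submodule.sub_mem _ (h2 hr)
      (𝒱.res_sub_prod_mem_degFil hp hq _ _))
  exact LinearMap.congr_fun (LinearMap.mem_ker.1 key) m

/-- Skew symmetry modulo `C_2(V)`, which `sigmaF` kills, moves `a` to the first argument. -/
theorem sigmaF_prod_left {s : ℤ} (hs : s = -1 ∨ s = 0) {a : V} (ha : 𝒱.sigmaF a = 0) (m : V) :
    𝒱.sigmaF (𝒱.prod m s a) = 0 := by
  have key : a ∈ LinearMap.ker ((𝒱.prodL s).flip.compr₂ 𝒱.sigmaF) := by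
    refine mem_of_proj_mem 𝒱.deg_internal _ fun p => ?_
    have hp := proj_mem 𝒱.deg_internal p a
    have h0 := 𝒱.isSymbolMap_sigmaF.map_proj_eq_zero 𝒱.deg_internal ha p
    generalize proj 𝒱.deg_internal p a = a at hp h0
    rw [LinearMap.mem_ker]
    refine 𝒱.bihom_ext fun q l m hq hl => ?_
    change 𝒱.sigmaF (𝒱.prod m s a) = 0
    have h := LinearMap.mem_ker.1 (𝒱.c2_le_sigmaF (𝒱.skew_mem_c2 hq hp s))
    rwa [map_add, Units.smul_def, map_zsmul, 𝒱.sigmaF_prod_right hs h0, smul_zero,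
      add_zero] at h
  exact LinearMap.congr_fun (LinearMap.mem_ker.1 key) m

theorem sigmaF_d {a : V} (ha : 𝒱.sigmaF a = 0) : 𝒱.sigmaF (𝒱.d a) = 0 := by
  refine mem_of_proj_mem 𝒱.deg_internal (LinearMap.ker (𝒱.sigmaF ∘ₗ 𝒱.d)) fun p => ?_
  have hp := proj_mem 𝒱.deg_internal p a
  have h0 := 𝒱.isSymbolMap_sigmaF.map_proj_eq_zero 𝒱.deg_internal ha p
  generalize proj 𝒱.deg_internal p a = a at hp h0
  rw [LinearMap.mem_ker, LinearMap.comp_apply,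
    𝒱.isSymbolMap_sigmaF.eq_zero_iff_of_mem 𝒱.deg_internal (𝒱.d_deg p a hp)]
  rw [𝒱.isSymbolMap_sigmaF.eq_zero_iff_of_mem 𝒱.deg_internal hp] at h0
  obtain ⟨r, hr, e⟩ := h0
  have h1 := 𝒱.d_mem_zhuO (𝒱.zhuMk_eq_iff.1 e.symm)
  rw [map_sub, ← zhuMk_eq_iff] at h1
  rw [h1]
  have h2 : 𝒱.degFil (p - 1) ≤ (𝒱.degFil (p + 1 - 1)).comap 𝒱.d :=
    iSup_le fun q u hu => 𝒱.deg_le_of (by have : q.1 ≤ p - 1 := q.2; lia) (𝒱.d_deg q u hu)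
  exact Submodule.mem_map_of_mem (h2 hr)

/-- `(Ker f) R(V) = Ker f` if `Ker f` is the kernel of the symbol maps. -/
theorem etaMk_eq_zero_iff {X : Type*} [AddCommGroup X] [Module ℂ X] {f : 𝒱.R →ₗ[ℂ] X}
    (hf : ∀ v, f (𝒱.rMk v) = 0 ↔ 𝒱.sigmaF v = 0) (v : V) :
    𝒱.etaMk f v = 0 ↔ 𝒱.sigmaF v = 0 := by
  have h : 𝒱.etaMk f v = 0 ↔ 𝒱.rMk v ∈ 𝒱.kerMul f := Submodule.Quotient.mk_eq_zero _
  rw [h, ← hf]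
  constructor
  · intro hv
    have : 𝒱.kerMul f ≤ LinearMap.ker f := by
      refine Submodule.span_le.2 ?_
      rintro _ ⟨a, m, ha, rfl⟩
      exact (hf _).2 (𝒱.sigmaF_prod_right (Or.inl rfl) ((hf a).1 ha) m)
    exact this hv
  · intro hv
    -- Creation, `v = v_{-1} 1`, puts the kernel inside the ideal that it generates.
    exact Submodule.subset_span ⟨v, 𝒱.one, hv, by rw [prod, 𝒱.creation]⟩

theorem etaMk_surjective {X : Type*} [AddCommGroup X] [Module ℂ X] (f : 𝒱.R →ₗ[ℂ] X) :
    Function.Surjective (𝒱.etaMk f) :=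
  (Submodule.mkQ_surjective _).comp (Submodule.mkQ_surjective _)

/-! ### The operations on quotients by the kernel -/

section Induced

variable {G X Y : Type*} [AddCommGroup G] [Module ℂ G] [AddCommGroup X] [Module ℂ X]
  [AddCommGroup Y] [Module ℂ Y]

/-- `t` presents `X` as the quotient of `V` by the kernel of the symbol maps. -/
structure IsSymbolQuotient (t : V →ₗ[ℂ] X) : Prop where
  surjective : Function.Surjective t
  eq_zero_iff : ∀ v, t v = 0 ↔ 𝒱.sigmaF v = 0

/-- The operations of `X` are those induced by the products `u_{-1} v` and `u_0 v` and by `d`. -/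
structure IsInduced (s : V →ₗ[ℂ] G) (t : V →ₗ[ℂ] X) (o : PoissonOps G X) : Prop where
  act : ∀ a m : V, o.act (s a) (t m) = t (𝒱.prod a (-1) m)
  bracket : ∀ a m : V, o.bracket (s a) (t m) = t (𝒱.prod a 0 m)
  d : ∀ m : V, o.d (t m) = t (𝒱.d m)

variable {𝒱}

/-- One source for all eight sets of operations: the kernel is a two-sided ideal for both products
and stable under `d`. -/
theorem IsSymbolQuotient.exists_isInduced {s : V →ₗ[ℂ] G} {t : V →ₗ[ℂ] X}
    (hs : 𝒱.IsSymbolQuotient s) (ht : 𝒱.IsSymbolQuotient t) :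
    ∃ o : PoissonOps G X, 𝒱.IsInduced s t o := by
  have h : ∀ n : ℤ, n = -1 ∨ n = 0 →
      ∃ g : G →ₗ[ℂ] X →ₗ[ℂ] X, ∀ u v, g (s u) (t v) = t (𝒱.prodL n u v) := fun n hn =>
    exists_descend₂ hs.surjective ht.surjective (𝒱.prodL n)
      (fun u v hu => (ht.eq_zero_iff _).2 (𝒱.sigmaF_prod_right hn ((hs.eq_zero_iff u).1 hu) v))
      (fun u v hv => (ht.eq_zero_iff _).2 (𝒱.sigmaF_prod_left hn ((ht.eq_zero_iff v).1 hv) u))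
  obtain ⟨f, hf⟩ := h (-1) (Or.inl rfl)
  obtain ⟨g, hg⟩ := h 0 (Or.inr rfl)
  obtain ⟨d, hd⟩ := exists_descend (t := t) ht.surjective 𝒱.d
    (fun v hv => (ht.eq_zero_iff _).2 (𝒱.sigmaF_d ((ht.eq_zero_iff v).1 hv)))
  exact ⟨{ act := f, bracket := g, d := d }, hf, hg, hd⟩

theorem IsSymbolQuotient.exists_map {t : V →ₗ[ℂ] X} {t' : V →ₗ[ℂ] Y} (ht : 𝒱.IsSymbolQuotient t)
    (ht' : 𝒱.IsSymbolQuotient t') : ∃ f : X →ₗ[ℂ] Y, ∀ v, f (t v) = t' v :=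
  exists_descend ht.surjective LinearMap.id
    fun v hv => (ht'.eq_zero_iff _).2 ((ht.eq_zero_iff v).1 hv)

theorem IsSymbolQuotient.bijective {t : V →ₗ[ℂ] X} {t' : V →ₗ[ℂ] Y} (ht : 𝒱.IsSymbolQuotient t)
    (ht' : 𝒱.IsSymbolQuotient t') {f : X →ₗ[ℂ] Y} (hf : ∀ v, f (t v) = t' v) :
    Function.Bijective f := by
  constructor
  · rw [injective_iff_map_eq_zero]
    intro x hx
    obtain ⟨v, rfl⟩ := ht.surjective x
    rw [hf, ht'.eq_zero_iff] at hx
    exact (ht.eq_zero_iff v).2 hx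
  · intro y
    obtain ⟨v, rfl⟩ := ht'.surjective y
    exact ⟨t v, hf v⟩

theorem IsInduced.isPoissonIso {s : V →ₗ[ℂ] G} {t : V →ₗ[ℂ] X} {t' : V →ₗ[ℂ] Y}
    {o : PoissonOps G X} {o' : PoissonOps G Y} (ho : 𝒱.IsInduced s t o) (ho' : 𝒱.IsInduced s t' o')
    (hs : 𝒱.IsSymbolQuotient s) (ht : 𝒱.IsSymbolQuotient t) (ht' : 𝒱.IsSymbolQuotient t')
    {f : X →ₗ[ℂ] Y} (hf : ∀ v, f (t v) = t' v) : IsPoissonIso o o' f where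
  map_act a x := by
    obtain ⟨a, rfl⟩ := hs.surjective a
    obtain ⟨x, rfl⟩ := ht.surjective x
    rw [ho.act, hf, hf, ho'.act]
  map_bracket a x := by
    obtain ⟨a, rfl⟩ := hs.surjective a
    obtain ⟨x, rfl⟩ := ht.surjective x
    rw [ho.bracket, hf, hf, ho'.bracket]
  map_d x := by
    obtain ⟨x, rfl⟩ := ht.surjective x
    rw [ho.d, hf, hf, ho'.d]
  bijective := ht.bijective ht' hf

end Induced

/-! ### All the spaces of the theorem as quotients of `V` by the common kernel -/

theorem isSymbolQuotient_sigmaF : 𝒱.IsSymbolQuotient 𝒱.sigmaF :=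
  ⟨𝒱.isSymbolMap_sigmaF.surjective 𝒱.deg_internal, fun _ => Iff.rfl⟩

theorem isSymbolQuotient_sigmaW : 𝒱.IsSymbolQuotient 𝒱.sigmaW :=
  ⟨𝒱.isSymbolMap_sigmaW.surjective 𝒱.weight_internal', fun _ => 𝒱.sigmaW_eq_zero_iff⟩

theorem isSymbolQuotient_sigmaWF : 𝒱.IsSymbolQuotient 𝒱.sigmaWF :=
  ⟨fun y => by
    obtain ⟨v, hv⟩ := 𝒱.isSymbolMap_sigmaWF.surjective 𝒱.weight_internal' y
    exact ⟨v, hv⟩, fun _ => 𝒱.sigmaWF_eq_zero_iff⟩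

theorem isSymbolQuotient_sigmaFW : 𝒱.IsSymbolQuotient 𝒱.sigmaFW :=
  ⟨𝒱.isSymbolMap_sigmaFW.surjective 𝒱.deg_internal, fun _ => 𝒱.sigmaFW_eq_zero_iff⟩

theorem isSymbolQuotient_etaMk_etaF : 𝒱.IsSymbolQuotient (𝒱.etaMk 𝒱.etaF) :=
  ⟨𝒱.etaMk_surjective _, 𝒱.etaMk_eq_zero_iff fun _ => Iff.rfl⟩

theorem isSymbolQuotient_etaMk_etaW : 𝒱.IsSymbolQuotient (𝒱.etaMk 𝒱.etaW) :=
  ⟨𝒱.etaMk_surjective _, 𝒱.etaMk_eq_zero_iff fun _ => 𝒱.sigmaW_eq_zero_iff⟩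

theorem isSymbolQuotient_etaMk_etaWF : 𝒱.IsSymbolQuotient (𝒱.etaMk 𝒱.etaWF) :=
  ⟨𝒱.etaMk_surjective _, 𝒱.etaMk_eq_zero_iff fun _ => 𝒱.sigmaWF_eq_zero_iff⟩

/-- The symbol map `V → gr_* η_F(R(V))` -/
def sigmaEtaF : V →ₗ[ℂ] 𝒱.GrEtaF :=
  symbolMap 𝒱.weight_internal' (𝒱.etaMk 𝒱.etaF) (𝒱.etaFilW 𝒱.etaF) fun _ => rfl

/-- The symbol map `V → gr^[*] η_W(R(V))` -/
def sigmaEtaW : V →ₗ[ℂ] 𝒱.GrEtaW :=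
  symbolMap 𝒱.deg_internal (𝒱.etaMk 𝒱.etaW) (𝒱.etaFilF 𝒱.etaW) fun _ => rfl

theorem isSymbolMap_sigmaEtaF :
    IsSymbolMap 𝒱.weight (𝒱.etaMk 𝒱.etaF) (𝒱.etaFilW 𝒱.etaF) 𝒱.sigmaEtaF :=
  isSymbolMap_symbolMap _ _ _ _

theorem isSymbolMap_sigmaEtaW :
    IsSymbolMap 𝒱.deg (𝒱.etaMk 𝒱.etaW) (𝒱.etaFilF 𝒱.etaW) 𝒱.sigmaEtaW :=
  isSymbolMap_symbolMap _ _ _ _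

theorem etaMk_etaF_proj (v : V) (k : ℤ) (hv : 𝒱.etaMk 𝒱.etaF v = 0) :
    𝒱.etaMk 𝒱.etaF (proj 𝒱.weight_internal' k v) = 0 := by
  rw [𝒱.isSymbolQuotient_etaMk_etaF.eq_zero_iff] at *
  exact 𝒱.sigmaF_proj_weight hv k

theorem etaMk_etaW_proj (v : V) (p : ℤ) (hv : 𝒱.etaMk 𝒱.etaW v = 0) :
    𝒱.etaMk 𝒱.etaW (proj 𝒱.deg_internal p v) = 0 := by
  rw [𝒱.isSymbolQuotient_etaMk_etaW.eq_zero_iff] at *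
  exact 𝒱.isSymbolMap_sigmaF.map_proj_eq_zero 𝒱.deg_internal hv p

theorem isSymbolQuotient_sigmaEtaF : 𝒱.IsSymbolQuotient 𝒱.sigmaEtaF := by
  refine ⟨𝒱.isSymbolMap_sigmaEtaF.surjective 𝒱.weight_internal', fun v => ?_⟩
  rw [← 𝒱.isSymbolQuotient_etaMk_etaF.eq_zero_iff, ← LinearMap.mem_ker,
    𝒱.isSymbolMap_sigmaEtaF.ker_eq 𝒱.weight_internal' 𝒱.etaMk_etaF_proj, LinearMap.mem_ker]

theorem isSymbolQuotient_sigmaEtaW : 𝒱.IsSymbolQuotient 𝒱.sigmaEtaW := by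
  refine ⟨𝒱.isSymbolMap_sigmaEtaW.surjective 𝒱.deg_internal, fun v => ?_⟩
  rw [← 𝒱.isSymbolQuotient_etaMk_etaW.eq_zero_iff, ← LinearMap.mem_ker,
    𝒱.isSymbolMap_sigmaEtaW.ker_eq 𝒱.deg_internal 𝒱.etaMk_etaW_proj, LinearMap.mem_ker]

theorem grEtaFPiece_eq (p k : ℤ) :
    𝒱.grEtaFPiece p k = (𝒱.deg p ⊓ 𝒱.weight k).map 𝒱.sigmaEtaF := by
  refine 𝒱.isSymbolMap_sigmaEtaF.map_piece 𝒱.weight_internal' 𝒱.etaMk_etaF_proj (𝒱.deg p)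
    (fun v k hv => ?_) k
  rw [← proj_same 𝒱.deg_internal hv]
  exact (𝒱.bihom_proj p k v).1

theorem grEtaWPiece_eq (p k : ℤ) :
    𝒱.grEtaWPiece p k = (𝒱.deg p ⊓ 𝒱.weight k).map 𝒱.sigmaEtaW := by
  rw [inf_comm]
  refine 𝒱.isSymbolMap_sigmaEtaW.map_piece 𝒱.deg_internal 𝒱.etaMk_etaW_proj (𝒱.weight k)
    (fun v p hv => ?_) p
  rw [← proj_same 𝒱.weight_internal' hv, proj_comm]
  exact (𝒱.bihom_proj p k v).2

/-! ### Agreement of the descended operations with the prescribed ones -/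

variable {𝒱}

theorem IsInduced.isGrF {o : PoissonOps 𝒱.GrF 𝒱.GrF} (ho : 𝒱.IsInduced 𝒱.sigmaF 𝒱.sigmaF o) :
    𝒱.IsGrF o where
  act p q k u m hu _ hm := by
    rw [ho.act]
    exact 𝒱.isSymbolMap_sigmaF.exists_eq_symb (𝒱.prod_neg_one_deg hu hm)
      (𝒱.starL_sub_mem_degFil hu hm k)
  bracket p q k u m hu _ hm := by
    rw [ho.bracket]
    exact 𝒱.isSymbolMap_sigmaF.exists_eq_symb (𝒱.prod_zero_deg hu hm)
      (𝒱.comm_sub_mem_degFil hu hm k)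
  d q m hm := by
    rw [ho.d]
    exact 𝒱.isSymbolMap_sigmaF.apply _ _ (𝒱.d_deg q m hm)

theorem IsInduced.isGrW {o : PoissonOps 𝒱.GrW 𝒱.GrW} (ho : 𝒱.IsInduced 𝒱.sigmaW 𝒱.sigmaW o) :
    𝒱.IsGrW o.toModOps where
  act k l u m hu hm := by
    rw [ho.act]
    exact 𝒱.isSymbolMap_sigmaW.exists_eq_symb (𝒱.prod_neg_one_weight hu hm)
      (𝒱.starL_sub_mem_weightFil hu hm)
  d l m hm := by
    rw [ho.d]
    exact 𝒱.isSymbolMap_sigmaW.apply _ _ (𝒱.d_weight hm)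

theorem IsInduced.isGrWF {o : PoissonOps 𝒱.GrWF 𝒱.GrWF}
    (ho : 𝒱.IsInduced 𝒱.sigmaWF 𝒱.sigmaWF o) : 𝒱.IsGrWF o where
  act p q k l u m hp hk hq hl := by
    rw [ho.act]
    exact 𝒱.exists_sigmaWF_eq (𝒱.prod_neg_one_deg hp hq) (𝒱.prod_neg_one_weight hk hl)
      (𝒱.starL_sub_mem_degFil hp hq k) (𝒱.starL_sub_mem_weightFil hk hl)
  bracket p q k l u m hp hk hq hl := by
    rw [ho.bracket]
    exact 𝒱.exists_sigmaWF_eq (𝒱.prod_zero_deg hp hq) (𝒱.prod_zero_weight hk hl)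
      (𝒱.comm_sub_mem_degFil hp hq k) (𝒱.comm_sub_mem_weightFil hk hl p q)
  d q l m hq hl := by
    rw [ho.d]
    exact ⟨_, 𝒱.sigmaWF_apply (𝒱.d_deg q m hq) (𝒱.d_weight hl)⟩

theorem IsInduced.isGrEtaF {o : PoissonOps 𝒱.GrWF 𝒱.GrEtaF}
    (ho : 𝒱.IsInduced 𝒱.sigmaWF 𝒱.sigmaEtaF o) : 𝒱.IsGrEtaF o where
  act p k l a m _ hk hl := by
    obtain ⟨h, e⟩ := 𝒱.isSymbolMap_sigmaEtaF.apply l m hl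
    obtain ⟨h', e'⟩ := 𝒱.isSymbolMap_sigmaEtaF.apply _ _ (𝒱.prod_neg_one_weight hk hl)
    exact ⟨h, h', by rw [← e, ho.act, e']⟩
  bracket p k l a m _ hk hl := by
    obtain ⟨h, e⟩ := 𝒱.isSymbolMap_sigmaEtaF.apply l m hl
    obtain ⟨h', e'⟩ := 𝒱.isSymbolMap_sigmaEtaF.apply _ _ (𝒱.prod_zero_weight hk hl)
    exact ⟨h, h', by rw [← e, ho.bracket, e']⟩
  d l m hl := by
    obtain ⟨h, e⟩ := 𝒱.isSymbolMap_sigmaEtaF.apply l m hl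
    obtain ⟨h', e'⟩ := 𝒱.isSymbolMap_sigmaEtaF.apply _ _ (𝒱.d_weight hl)
    exact ⟨h, h', by rw [← e, ho.d, e']⟩

theorem IsInduced.isGrEtaW {o : PoissonOps 𝒱.GrWF 𝒱.GrEtaW}
    (ho : 𝒱.IsInduced 𝒱.sigmaWF 𝒱.sigmaEtaW o) : 𝒱.IsGrEtaW o where
  act p q k a m hp _ hq := by
    obtain ⟨h, e⟩ := 𝒱.isSymbolMap_sigmaEtaW.apply q m hq
    obtain ⟨h', e'⟩ := 𝒱.isSymbolMap_sigmaEtaW.apply _ _ (𝒱.prod_neg_one_deg hp hq)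
    exact ⟨h, h', by rw [← e, ho.act, e']⟩
  bracket p q k a m hp _ hq := by
    obtain ⟨h, e⟩ := 𝒱.isSymbolMap_sigmaEtaW.apply q m hq
    obtain ⟨h', e'⟩ := 𝒱.isSymbolMap_sigmaEtaW.apply _ _ (𝒱.prod_zero_deg hp hq)
    exact ⟨h, h', by rw [← e, ho.bracket, e']⟩
  d q m hq := by
    obtain ⟨h, e⟩ := 𝒱.isSymbolMap_sigmaEtaW.apply q m hq
    obtain ⟨h', e'⟩ := 𝒱.isSymbolMap_sigmaEtaW.apply _ _ (𝒱.d_deg q m hq)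
    exact ⟨h, h', by rw [← e, ho.d, e']⟩

end DGVertexOperatorAlgebra

/-! ### Assembly of the morphisms -/

theorem map_map_of_comp {V X Y : Type*} [AddCommGroup V] [Module ℂ V] [AddCommGroup X] [Module ℂ X]
    [AddCommGroup Y] [Module ℂ Y] {t : V →ₗ[ℂ] X} {t' : V →ₗ[ℂ] Y} {f : X →ₗ[ℂ] Y}
    (hf : ∀ v, f (t v) = t' v) (S : Submodule ℂ V) : (S.map t).map f = S.map t' := by
  rw [← Submodule.map_comp]
  congr 1
  exact LinearMap.ext hf

end DGVertex

end

theorem mainTheorem6 {V : Type*} [AddCommGroup V] [Module ℂ V]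
    (𝒱 : DGVertex.DGVertexOperatorAlgebra V) :
    -- the induced operations on the graded spaces of `A(V)` and on the modules `η(R(V))` exist
    ∃ (mF : DGVertex.PoissonOps 𝒱.GrF 𝒱.GrF) (mW : DGVertex.ModOps 𝒱.GrW 𝒱.GrW)
      (mWF : DGVertex.PoissonOps 𝒱.GrWF 𝒱.GrWF)
      (eF : DGVertex.PoissonOps 𝒱.GrF 𝒱.EtaF) (eW : DGVertex.ModOps 𝒱.GrW 𝒱.EtaW)
      (eWF : DGVertex.PoissonOps 𝒱.GrWF 𝒱.EtaWF)
      (gF : DGVertex.PoissonOps 𝒱.GrWF 𝒱.GrEtaF) (gW : DGVertex.PoissonOps 𝒱.GrWF 𝒱.GrEtaW)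
      -- the canonical identification of the two double gradeds
      (τ : 𝒱.GrFW ≃ₗ[ℂ] 𝒱.GrWF),
      𝒱.IsGrF mF ∧ 𝒱.IsGrW mW ∧ 𝒱.IsGrWF mWF ∧
      𝒱.IsEtaPoisson 𝒱.etaF eF ∧ 𝒱.IsEtaMod 𝒱.etaW eW ∧ 𝒱.IsEtaPoisson 𝒱.etaWF eWF ∧
      𝒱.IsGrEtaF gF ∧ 𝒱.IsGrEtaW gW ∧
      (∀ (p k : ℤ) (x : 𝒱.Zhu) (hF : x ∈ 𝒱.zhuF p) (hW : x ∈ 𝒱.zhuW k),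
        τ (DGVertex.symb₂ 𝒱.zhuW 𝒱.zhuF k p ⟨x, hW, hF⟩) =
          DGVertex.symb₂ 𝒱.zhuF 𝒱.zhuW p k ⟨x, hF, hW⟩) ∧
      -- `Ψ_V`
      (∃ Ψ : 𝒱.EtaWF →ₗ[ℂ] 𝒱.GrWF,
        (∀ m : V, Ψ (𝒱.etaMk 𝒱.etaWF m) = 𝒱.sigmaWF m) ∧
        DGVertex.IsPoissonIso eWF mWF Ψ ∧
        ∀ p k : ℤ, ((𝒱.deg p ⊓ 𝒱.weight k).map (𝒱.etaMk 𝒱.etaWF)).map Ψ =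
          LinearMap.range (DGVertex.symb₂ 𝒱.zhuF 𝒱.zhuW p k)) ∧
      -- `ψ_V` and `(gr_* ψ)_V`
      (∃ ψ : 𝒱.EtaF →ₗ[ℂ] 𝒱.GrF,
        (∀ m : V, ψ (𝒱.etaMk 𝒱.etaF m) = 𝒱.sigmaF m) ∧
        DGVertex.IsPoissonIso eF mF ψ ∧
        (∀ p : ℤ, ((𝒱.deg p).map (𝒱.etaMk 𝒱.etaF)).map ψ =
          LinearMap.range (DGVertex.symb 𝒱.zhuF p)) ∧
        ∃ hψ : ∀ k : ℤ, (𝒱.etaFilW 𝒱.etaF k).map ψ ≤ DGVertex.inducedFil 𝒱.zhuF 𝒱.zhuW k,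
          DGVertex.IsPoissonIso gF mWF (DGVertex.grMap ψ hψ) ∧
          ∀ p k : ℤ, (𝒱.grEtaFPiece p k).map (DGVertex.grMap ψ hψ) =
            LinearMap.range (DGVertex.symb₂ 𝒱.zhuF 𝒱.zhuW p k)) ∧
      -- `φ_V` and `(gr^[*] φ)_V`
      (∃ φ : 𝒱.EtaW →ₗ[ℂ] 𝒱.GrW,
        (∀ m : V, φ (𝒱.etaMk 𝒱.etaW m) = 𝒱.sigmaW m) ∧
        DGVertex.IsModHom eW mW φ ∧
        (∀ k : ℤ, ((𝒱.weight k).map (𝒱.etaMk 𝒱.etaW)).map φ =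
          LinearMap.range (DGVertex.symb 𝒱.zhuW k)) ∧
        (∃ hφ : ∀ p : ℤ, (𝒱.etaFilF 𝒱.etaW p).map φ ≤ DGVertex.inducedFil 𝒱.zhuW 𝒱.zhuF p,
          DGVertex.IsPoissonIso gW mWF (τ.toLinearMap ∘ₗ DGVertex.grMap φ hφ) ∧
          ∀ p k : ℤ, (𝒱.grEtaWPiece p k).map (τ.toLinearMap ∘ₗ DGVertex.grMap φ hφ) =
            LinearMap.range (DGVertex.symb₂ 𝒱.zhuF 𝒱.zhuW p k)) ∧
        ((∃ N : ℤ, ∀ p < N, 𝒱.deg p = ⊥) →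
          Function.Bijective φ ∧
          ∀ p : ℤ, (𝒱.etaFilF 𝒱.etaW p).map φ = DGVertex.inducedFil 𝒱.zhuW 𝒱.zhuF p)) := by
  have sF := 𝒱.isSymbolQuotient_sigmaF
  have sW := 𝒱.isSymbolQuotient_sigmaW
  have sWF := 𝒱.isSymbolQuotient_sigmaWF
  have tF := 𝒱.isSymbolQuotient_etaMk_etaF
  have tW := 𝒱.isSymbolQuotient_etaMk_etaW
  have tWF := 𝒱.isSymbolQuotient_etaMk_etaWF
  have gsF := 𝒱.isSymbolQuotient_sigmaEtaF
  have gsW := 𝒱.isSymbolQuotient_sigmaEtaW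
  obtain ⟨mF, hmF⟩ := sF.exists_isInduced sF
  obtain ⟨mW, hmW⟩ := sW.exists_isInduced sW
  obtain ⟨mWF, hmWF⟩ := sWF.exists_isInduced sWF
  obtain ⟨eF, heF⟩ := sF.exists_isInduced tF
  obtain ⟨eW, heW⟩ := sW.exists_isInduced tW
  obtain ⟨eWF, heWF⟩ := sWF.exists_isInduced tWF
  obtain ⟨gF, hgF⟩ := sWF.exists_isInduced gsF
  obtain ⟨gW, hgW⟩ := sWF.exists_isInduced gsW
  -- This map and the next three are determined by compatibility with the maps from `V`.
  obtain ⟨τ, hτ⟩ := 𝒱.isSymbolQuotient_sigmaFW.exists_map sWF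
  obtain ⟨Ψ, hΨ⟩ := tWF.exists_map sWF
  obtain ⟨ψ, hψ⟩ := tF.exists_map sF
  obtain ⟨φ, hφ⟩ := tW.exists_map sW
  have hψW : ∀ k : ℤ, (𝒱.etaFilW 𝒱.etaF k).map ψ ≤ DGVertex.inducedFil 𝒱.zhuF 𝒱.zhuW k :=
    fun k => (DGVertex.map_map_of_comp hψ _).trans_le (𝒱.inducedFil_zhuF_zhuW k).ge
  have hφF : ∀ p : ℤ, (𝒱.etaFilF 𝒱.etaW p).map φ = DGVertex.inducedFil 𝒱.zhuW 𝒱.zhuF p :=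
    fun p => (DGVertex.map_map_of_comp hφ _).trans (𝒱.inducedFil_zhuW_zhuF p).symm
  have hgψ := 𝒱.isSymbolMap_sigmaEtaF.grMap_comp 𝒱.weight_internal' 𝒱.isSymbolMap_sigmaWF ψ hψ hψW
  have hgφ : ∀ v, (τ ∘ₗ DGVertex.grMap φ fun p => (hφF p).le) (𝒱.sigmaEtaW v) = 𝒱.sigmaWF v := by
    intro v
    rw [LinearMap.comp_apply, 𝒱.isSymbolMap_sigmaEtaW.grMap_comp 𝒱.deg_internal
      𝒱.isSymbolMap_sigmaFW φ hφ, hτ]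
  refine ⟨mF, mW.toModOps, mWF, eF, eW.toModOps, eWF, gF, gW,
    LinearEquiv.ofBijective τ (𝒱.isSymbolQuotient_sigmaFW.bijective sWF hτ),
    hmF.isGrF, hmW.isGrW, hmWF.isGrWF, ⟨⟨heF.act, heF.d⟩, heF.bracket⟩, ⟨heW.act, heW.d⟩,
    ⟨⟨heWF.act, heWF.d⟩, heWF.bracket⟩, hgF.isGrEtaF, hgW.isGrEtaW, ?_,
    ⟨Ψ, hΨ, heWF.isPoissonIso hmWF sWF tWF sWF hΨ, fun p k => ?_⟩,
    ⟨ψ, hψ, heF.isPoissonIso hmF sF tF sF hψ, fun p => ?_, hψW,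
      hgF.isPoissonIso hmWF sWF gsF sWF hgψ, fun p k => ?_⟩,
    ⟨φ, hφ, (heW.isPoissonIso hmW sW tW sW hφ).toIsModHom, fun k => ?_,
      ⟨fun p => (hφF p).le, hgW.isPoissonIso hmWF sWF gsW sWF hgφ, fun p k => ?_⟩,
      fun _ => ⟨tW.bijective sW hφ, hφF⟩⟩⟩
  · intro p k x hF hW
    have hx : x ∈ 𝒱.zhuF p ⊓ 𝒱.zhuW k := ⟨hF, hW⟩
    have hx' := hx
    rw [𝒱.zhuF_inf_zhuW] at hx'
    obtain ⟨c, hc, rfl⟩ := hx'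
    -- With `c` in `F^p V ∩ W_n V`, both iterated symbols come from the same bihomogeneous component
    -- of `c`.
    exact (congrArg τ (𝒱.symb₂_eq' hc ⟨hW, hF⟩)).trans ((hτ _).trans (𝒱.symb₂_eq hc hx).symm)
  · rw [DGVertex.map_map_of_comp hΨ, 𝒱.map_sigmaWF]
  · rw [DGVertex.map_map_of_comp hψ]
    exact 𝒱.isSymbolMap_sigmaF.map_grade 𝒱.deg_internal p
  · rw [𝒱.grEtaFPiece_eq, DGVertex.map_map_of_comp hgψ, 𝒱.map_sigmaWF]
  · rw [DGVertex.map_map_of_comp hφ]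
    exact 𝒱.isSymbolMap_sigmaW.map_grade 𝒱.weight_internal' k
  · rw [𝒱.grEtaWPiece_eq, ← 𝒱.map_sigmaWF]
    exact DGVertex.map_map_of_comp hgφ _
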